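/- All graphs are finite and simple. The Laplacian spectrum of a graph is the multiset of eigenvalues (with multiplicity) of its Laplacian matrix $D-A$, where $D$ is the diagonal matrix of vertex degrees and $A$ is the adjacency matrix. A graph is sun-like if it is connected and deleting all of its vertices of degree $1$ yields a cycle; for $i\ge 1$, an $i$-hub of a sun-like graph is a vertex of this cycle with exactly $i$ leaves attached to it (equivalently, a vertex of degree $i+2$), and a hub is a vertex that is an $i$-hub for some $i\ge 1$. For integers $k\ge 1$ and $\ell\ge\max(12k,15)$, a graph is $(\ell,k)$-nice if it is sun-like, its unique cycle $C$ has length $\ell$, it has exactly $k+1$ hubs, one of which is a $1$-hub and the others of which are $2$-hubs, and $C$ can be oriented so that, walking clockwise around $C$ from the $1$-hub, the first $2$-hub is met after a distance of exactly $4$, and each subsequent $2$-hub (up to the $k$-th) appears at distance $4$ or $6$ after the previous one. Lemma 4.2. Let $k\ge 1$ and $\ell\ge\max(12k,15)$ be integers, let $G$ be an $(\ell,k)$-nice graph, and let $H$ be a graph with the same Laplacian spectrum as $G$. Then $H$ is an $(\ell,k)$-nice graph. -/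

import Mathlib

namespace SpectralNice

/-- The Laplacian spectrum of a finite graph: the multiset of eigenvalues, with multiplicity,
of the Laplacian matrix `D - A`. (This matrix is real symmetric, so its characteristic polynomial
splits over `ℝ`, and the real roots are all the eigenvalues.) -/
noncomputable def laplacianSpectrum {V : Type*} [Fintype V] [DecidableEq V]
    (G : SimpleGraph V) [DecidableRel G.Adj] : Multiset ℝ :=
  (G.lapMatrix ℝ).charpoly.roots

/-- The graph obtained from `G` by deleting all vertices of degree 1. -/
abbrev core {V : Type*} [Fintype V] (G : SimpleGraph V) [DecidableRel G.Adj] :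
    SimpleGraph {v : V | G.degree v ≠ 1} :=
  G.induce {v : V | G.degree v ≠ 1}

/-- `G` is sun-like with cycle of length `ℓ`: it is connected, and deleting all degree-1 vertices
yields a cycle of length `ℓ` (a cycle has length at least 3). -/
structure IsSunLike {V : Type*} [Fintype V] (G : SimpleGraph V) [DecidableRel G.Adj]
    (ℓ : ℕ) : Prop where
  connected : G.Connected
  three_le : 3 ≤ ℓ
  core_cycle : Nonempty (SimpleGraph.cycleGraph ℓ ≃g core G)

/-- An `i`-hub (`i ≥ 1`) of a sun-like graph: a vertex of degree `i + 2`, that is, a vertex of the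
cycle with exactly `i` leaves attached to it. -/
def IsIHub {V : Type*} [Fintype V] (G : SimpleGraph V) [DecidableRel G.Adj]
    (i : ℕ) (v : V) : Prop :=
  1 ≤ i ∧ G.degree v = i + 2

/-- A hub is an `i`-hub for some `i ≥ 1`. -/
def IsHub {V : Type*} [Fintype V] (G : SimpleGraph V) [DecidableRel G.Adj] (v : V) : Prop :=
  ∃ i, IsIHub G i v

/-- `(ℓ, k)`-nice graphs. -/
structure IsNice {V : Type*} [Fintype V] (G : SimpleGraph V) [DecidableRel G.Adj]
    (ℓ k : ℕ) : Prop where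
  one_le : 1 ≤ k
  max_le : max (12 * k) 15 ≤ ℓ
  sunLike : IsSunLike G ℓ
  /-- there are exactly `k + 1` hubs, -/
  card_hubs : {v : V | IsHub G v}.ncard = k + 1
  /-- exactly one of which is a 1-hub, -/
  one_hub : ∃! v : V, IsIHub G 1 v
  /-- and the others are 2-hubs. -/
  two_hubs : ∀ v : V, IsHub G v → IsIHub G 1 v ∨ IsIHub G 2 v
  /-- There is a clockwise enumeration `φ 0, φ 1, …, φ (ℓ - 1)` of the cycle, starting at the 1-hub
  `φ 0`, and there are positions `p 1, …, p k < ℓ` of 2-hubs such that `p 1 = 4` and each further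
  position is 4 or 6 after the previous one. (The positions are strictly increasing, so together
  with the number of hubs this says that the hubs met on one clockwise tour are exactly these,
  in this order. The values of `p` beyond `k` are irrelevant.) -/
  positions : ∃ (φ : SimpleGraph.cycleGraph ℓ ≃g core G) (p : ℕ → Fin ℓ),
    (p 0 : ℕ) = 0 ∧ IsIHub G 1 (φ (p 0) : V) ∧
    (p 1 : ℕ) = 4 ∧
    (∀ j, 1 ≤ j → j < k →
      (p (j + 1) : ℕ) = (p j : ℕ) + 4 ∨ (p (j + 1) : ℕ) = (p j : ℕ) + 6) ∧
    ∀ j, 1 ≤ j → j ≤ k → IsIHub G 2 (φ (p j) : V)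

end SpectralNice

/-! The proof has three stages.

Global shape. The spectrum determines the order, connectedness (multiplicity of the eigenvalue 0)
and the traces of powers of L. The first two traces give the number of edges and the sum of squared
degrees, so H, like G, is unicyclic. The linear coefficient of the characteristic polynomial is, up
to sign, the order times the number of spanning trees, which for a unicyclic graph is the cycle
length. With cycle length at least 4 there are no triangles, so the third trace gives the sum of
cubed degrees. Now sum P(d) = (d-2)(d-3)(d-4) over the vertices: it vanishes at 2, 3, 4, equals -6
at 1 and is positive from 5 on. G attains the least value possible for a connected unicyclic graph
of this order and cycle length. Hence H does too, which makes H sun-like of maximum degree at most 4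
(`core_iso_of_charpoly_eq`). The degree sums then give the same numbers of 1-hubs and 2-hubs.

Distances between hubs. Eliminating the leaves leaves a matrix on the cycle that depends only on the
hub weights. Put x = 2 - q - 1/q and multiply by the Green's function of the cycle
(`hubMatrix_eval_eq`). The result is a polynomial matrix in q whose off-diagonal entries carry q to
the power 1 plus a hub distance. In the Leibniz expansion the identity contributes a term fixed by
the numbers of hubs. Transpositions record pairs of hubs at distance d in order 2d + 2, and longer
permutations start at order 3D + 3 when hubs are D apart. With D = 4 this exposes all distances up
to 6 (`HasNiceCounts.transfer`). Hubs of H are at least 4 apart and never 5 apart, exactly one pair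
at distance 4 involves the 1-hub, and at least k ordered pairs are at clockwise distance 4 or 6.

Reconstruction. Orient the cycle so that a 2-hub follows the 1-hub at distance 4. Parity excludes a
pair at distance 6 involving the 1-hub. Each of the k other hubs is then the end of exactly one link
of length 4 or 6, so all successive gaps are 4 or 6 (`exists_positions`). -/

namespace SpectralNice

open Matrix Polynomial

/-! ### Invariants read off the characteristic polynomial -/

section Spectrum

variable {V W : Type*} [Fintype V] [DecidableEq V] [Fintype W] [DecidableEq W]

theorem charpoly_eq_of_laplacianSpectrum_eq {G : SimpleGraph V} [DecidableRel G.Adj]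
    {H : SimpleGraph W} [DecidableRel H.Adj]
    (h : laplacianSpectrum H = laplacianSpectrum G) :
    (H.lapMatrix ℝ).charpoly = (G.lapMatrix ℝ).charpoly := by
  have e1 := (H.isHermitian_lapMatrix ℝ).splits_charpoly.eq_prod_roots_of_monic
    (charpoly_monic _)
  have e2 := (G.isHermitian_lapMatrix ℝ).splits_charpoly.eq_prod_roots_of_monic
    (charpoly_monic _)
  unfold laplacianSpectrum at h
  rw [e1, e2, h]

theorem card_eq_of_charpoly_eq {A : Matrix V V ℝ} {B : Matrix W W ℝ}
    (h : A.charpoly = B.charpoly) : Fintype.card V = Fintype.card W := by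
  rw [← charpoly_natDegree_eq_dim A, ← charpoly_natDegree_eq_dim B, h]

theorem trace_pow_eq_sum_roots {A : Matrix V V ℝ} (hA : A.IsHermitian) (m : ℕ) :
    (A ^ m).trace = (A.charpoly.roots.map (· ^ m)).sum := by
  have h1 : (A ^ m).trace = (diagonal (hA.eigenvalues) ^ m).trace := by
    conv_lhs => rw [hA.spectral_theorem]
    rw [← map_pow, Unitary.conjStarAlgAut_apply, Matrix.trace_mul_cycle]
    simp
  rw [h1, hA.roots_charpoly_eq_eigenvalues, diagonal_pow, trace_diagonal]
  simp

theorem card_connectedComponent_eq_count_roots (G : SimpleGraph V) [DecidableRel G.Adj] :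
    Nat.card G.ConnectedComponent = (G.lapMatrix ℝ).charpoly.roots.count 0 := by
  classical
  have hA := G.isHermitian_lapMatrix ℝ
  rw [Nat.card_eq_fintype_card, G.card_connectedComponent_eq_finrank_ker_toLin'_lapMatrix]
  have h1 := (G.lapMatrix ℝ).toLin'.finrank_range_add_finrank_ker
  have h2 : Module.finrank ℝ (G.lapMatrix ℝ).toLin'.range = (G.lapMatrix ℝ).rank := rfl
  rw [h2, hA.rank_eq_card_non_zero_eigs, Module.finrank_fintype_fun_eq_card,
    Fintype.card_subtype_compl, Fintype.card_subtype] at h1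
  have h3 : (Finset.univ.filter (fun i => hA.eigenvalues i = 0)).card ≤ Fintype.card V :=
    Finset.card_le_univ _
  have h4 : (G.lapMatrix ℝ).charpoly.roots.count 0 =
      (Finset.univ.filter (fun i => hA.eigenvalues i = 0)).card := by
    rw [hA.roots_charpoly_eq_eigenvalues, Multiset.count_map, Finset.card_def, Finset.filter_val]
    simp [eq_comm]
  omega

theorem connected_iff_count_roots (G : SimpleGraph V) [DecidableRel G.Adj] :
    G.Connected ↔ (G.lapMatrix ℝ).charpoly.roots.count 0 = 1 := by
  rw [← card_connectedComponent_eq_count_roots, SimpleGraph.connected_iff_exists_forall_reachable,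
    Nat.card_eq_one_iff_exists]
  constructor
  · rintro ⟨v, hv⟩
    refine ⟨G.connectedComponentMk v, fun c => ?_⟩
    induction c using SimpleGraph.ConnectedComponent.ind with
    | _ w => exact SimpleGraph.ConnectedComponent.sound (hv w).symm
  · rintro ⟨c, hc⟩
    induction c using SimpleGraph.ConnectedComponent.ind with
    | _ v => exact ⟨v, fun w => SimpleGraph.ConnectedComponent.exact (hc _).symm⟩

/-- The principal minors of order one less than the size are the diagonal entries of the adjugate.
-/
theorem coeff_one_charpoly (A : Matrix V V ℝ) [Nonempty V] :
    A.charpoly.coeff 1 = (-1) ^ (Fintype.card V - 1) * A.adjugate.trace := by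
  have hpos : 0 < Fintype.card V := Fintype.card_pos
  have h := A.charpoly_coeff_eq_sum_minors (Fintype.card V - 1) (Nat.sub_le _ _)
  rw [show Fintype.card V - (Fintype.card V - 1) = 1 by omega] at h
  rw [h]
  congr 1
  have himg : Finset.univ.powersetCard (Fintype.card V - 1) =
      Finset.univ.image (fun r : V => Finset.univ.erase r) := by
    ext s
    simp only [Finset.mem_powersetCard, Finset.subset_univ, true_and, Finset.mem_image,
      Finset.mem_univ]
    constructor
    · intro hs
      have : sᶜ.card = 1 := by rw [Finset.card_compl]; omega
      obtain ⟨r, hr⟩ := Finset.card_eq_one.mp this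
      exact ⟨r, by rw [← compl_compl s, hr]; ext; simp⟩
    · rintro ⟨r, rfl⟩
      simp
  rw [himg, Finset.sum_image]
  · refine Finset.sum_congr rfl fun r _ => ?_
    rw [← det_piecewise_one_eq_submatrix_det, Matrix.diag_apply, adjugate_apply]
    congr 1
    ext i j
    by_cases hi : i = r
    · subst hi
      simp [Matrix.one_apply, Pi.single_apply, eq_comm]
    · simp [hi]
  · intro a _ b _ hab
    by_contra hne
    have : a ∈ (Finset.univ.erase b : Finset V) := by simp [hne]
    simp only at hab
    rw [← hab] at this
    simp at this

end Spectrum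

/-! ### Traces of powers of the Laplacian in terms of degrees -/

section Traces

variable {V : Type*} [Fintype V] [DecidableEq V] (G : SimpleGraph V) [DecidableRel G.Adj]

theorem trace_lapMatrix : (G.lapMatrix ℝ).trace = ∑ v, (G.degree v : ℝ) := by
  simp [SimpleGraph.lapMatrix, SimpleGraph.degMatrix, trace_sub]

theorem trace_lapMatrix_sq :
    ((G.lapMatrix ℝ) ^ 2).trace = ∑ v, ((G.degree v : ℝ) ^ 2 + G.degree v) := by
  have h0 : ∀ v, (G.adjMatrix ℝ * G.adjMatrix ℝ) v v = G.degree v :=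
    fun v => G.adjMatrix_mul_self_apply_self v
  simp only [SimpleGraph.lapMatrix, SimpleGraph.degMatrix, Matrix.trace, Matrix.diag, pow_two,
    sub_mul, mul_sub, Matrix.sub_apply, h0, diagonal_mul, mul_diagonal, diagonal_apply_eq]
  simp

/-- In the expansion of (D - A)³ the terms with a single A have trace zero, because A has zero
diagonal, and those with two see only the degrees through the diagonal of A². Only the triangle term
tr A³ is not a function of the degrees. -/
theorem trace_lapMatrix_cube :
    ((G.lapMatrix ℝ) ^ 3).trace = ∑ v, ((G.degree v : ℝ) ^ 3 + 3 * (G.degree v : ℝ) ^ 2) -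
      ((G.adjMatrix ℝ) ^ 3).trace := by
  set A := G.adjMatrix ℝ with hA
  set D := G.degMatrix ℝ with hD
  have h0 : ∀ v, (A * A) v v = G.degree v := fun v => G.adjMatrix_mul_self_apply_self v
  have e : (G.lapMatrix ℝ) ^ 3 = D ^ 3 - D * D * A - D * A * D - A * D * D + D * (A * A) +
      A * D * A + A * A * D - A ^ 3 := by
    rw [SimpleGraph.lapMatrix]; noncomm_ring
  have e1 : (A * D * A).trace = (D * (A * A)).trace := by
    rw [Matrix.trace_mul_comm, ← mul_assoc, Matrix.trace_mul_comm]
  have e2 : (A * A * D).trace = (D * (A * A)).trace := Matrix.trace_mul_comm _ _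
  have e3 : (D * A * D).trace = (D * D * A).trace := by
    rw [Matrix.trace_mul_comm, mul_assoc]
  have e4 : (A * D * D).trace = (D * D * A).trace := by
    rw [mul_assoc, Matrix.trace_mul_comm]
  have e5 : (D * D * A).trace = 0 := by
    refine Finset.sum_eq_zero fun v _ => ?_
    rw [hD, hA, SimpleGraph.degMatrix, diagonal_mul_diagonal, Matrix.diag_apply, diagonal_mul]
    simp
  have e6 : (D * (A * A)).trace = ∑ v, (G.degree v : ℝ) ^ 2 := by
    simp only [Matrix.trace, Matrix.diag, hD, SimpleGraph.degMatrix, diagonal_mul, h0, pow_two]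
  have e7 : (D ^ 3).trace = ∑ v, (G.degree v : ℝ) ^ 3 := by
    simp [hD, SimpleGraph.degMatrix, diagonal_pow]
  simp only [e, trace_add, trace_sub, e1, e2, e3, e4, e5, e6, e7, Finset.sum_add_distrib,
    ← Finset.mul_sum]
  ring

theorem trace_adjMatrix_cube_eq_zero
    (h : ∀ u v w, G.Adj u v → G.Adj v w → G.Adj w u → False) :
    ((G.adjMatrix ℝ) ^ 3).trace = 0 := by
  rw [Matrix.trace]
  refine Finset.sum_eq_zero fun u _ => ?_
  rw [pow_succ, pow_two, Matrix.diag_apply, Matrix.mul_apply]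
  refine Finset.sum_eq_zero fun w _ => ?_
  rw [Matrix.mul_apply, Finset.sum_mul]
  refine Finset.sum_eq_zero fun v _ => ?_
  simp only [SimpleGraph.adjMatrix_apply]
  by_cases h1 : G.Adj u v <;> by_cases h2 : G.Adj v w <;> by_cases h3 : G.Adj w u <;>
    simp [h1, h2, h3]
  exact h u v w h1 h2 h3

end Traces

/-! ### Cofactors of the Laplacian and the spanning tree count -/

section Adjugate

variable {V : Type*} [Fintype V] [DecidableEq V] (G : SimpleGraph V) [DecidableRel G.Adj]

/-- Since L · adj L = 0, each column of the adjugate lies in the kernel of L, which for a connected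
graph consists of the constants. Symmetry then identifies different columns. -/
theorem adjugate_lapMatrix_apply_eq (hG : G.Connected) (u v : V) :
    (G.lapMatrix ℝ).adjugate u u = (G.lapMatrix ℝ).adjugate v v := by
  have := hG.nonempty
  have h0 := G.det_lapMatrix_eq_zero
  have hmul := mul_adjugate (G.lapMatrix ℝ)
  rw [h0, zero_smul] at hmul
  have hcol : ∀ j a b, (G.lapMatrix ℝ).adjugate a j = (G.lapMatrix ℝ).adjugate b j := by
    intro j a b
    have : (G.lapMatrix ℝ).mulVec (fun i => (G.lapMatrix ℝ).adjugate i j) = 0 := by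
      ext i
      exact congrFun (congrFun hmul i) j
    exact G.lapMatrix_mulVec_eq_zero_iff_forall_reachable.mp this a b (hG.preconnected a b)
  have hsym : (G.lapMatrix ℝ).adjugateᵀ = (G.lapMatrix ℝ).adjugate := by
    rw [adjugate_transpose, (G.isSymm_lapMatrix ℝ).eq]
  calc _ = (G.lapMatrix ℝ).adjugate v u := hcol u u v
    _ = (G.lapMatrix ℝ).adjugate u v := congrFun (congrFun hsym u) v
    _ = _ := hcol v u v

/-- Linearity of the determinant in row r, together with det L = 0. This expresses the cofactor, the
number of spanning trees, without deleting a row and column. -/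
theorem det_lapMatrix_add_single [Nonempty V] (r : V) :
    (G.lapMatrix ℝ + Matrix.single r r 1).det = (G.lapMatrix ℝ).adjugate r r := by
  have h : G.lapMatrix ℝ + Matrix.single r r 1 =
      (G.lapMatrix ℝ).updateRow r (G.lapMatrix ℝ r + Pi.single r 1) := by
    ext i j
    by_cases hi : i = r
    · subst hi
      simp [Matrix.single_apply, Pi.single_apply, eq_comm]
    · simp [hi, Ne.symm hi]
  rw [h, det_updateRow_add, updateRow_eq_self, G.det_lapMatrix_eq_zero, zero_add, adjugate_apply]

/-- The linear coefficient of the Laplacian characteristic polynomial. -/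
theorem coeff_one_charpoly_lapMatrix (hG : G.Connected) (r : V) :
    (G.lapMatrix ℝ).charpoly.coeff 1 = (-1) ^ (Fintype.card V - 1) *
      (Fintype.card V * (G.lapMatrix ℝ + Matrix.single r r 1).det) := by
  have := hG.nonempty
  rw [coeff_one_charpoly, det_lapMatrix_add_single, Matrix.trace]
  simp only [Matrix.diag_apply, adjugate_lapMatrix_apply_eq G hG _ r]
  simp

end Adjugate

/-! ### Schur complement of a scalar block -/

section Schur

variable {V : Type*} [Fintype V] [DecidableEq V]

theorem det_eq_of_scalar_block (M : Matrix V V ℝ) (S : Set V) [Fintype S]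
    [Fintype (Sᶜ : Set V)] {d : ℝ} (hd : d ≠ 0)
    (hD : ∀ a b, a ∉ S → b ∉ S → M a b = if a = b then d else 0) :
    M.det = d ^ Fintype.card (Sᶜ : Set V) *
      (Matrix.of fun u v : S => M u v - d⁻¹ * ∑ l : (Sᶜ : Set V), M u l * M l v).det := by
  classical
  let e := Equiv.Set.sumCompl S
  let hDinv : Invertible (d • (1 : Matrix (Sᶜ : Set V) (Sᶜ : Set V) ℝ)) :=
    ⟨d⁻¹ • 1, by simp [smul_smul, hd], by simp [smul_smul, hd]⟩
  have hb : M.submatrix e e = Matrix.fromBlocks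
      (M.submatrix Subtype.val Subtype.val) (M.submatrix Subtype.val Subtype.val)
      (M.submatrix Subtype.val Subtype.val) (d • (1 : Matrix (Sᶜ : Set V) (Sᶜ : Set V) ℝ)) := by
    ext (i | i) (j | j)
    · rfl
    · rfl
    · rfl
    · simp only [submatrix_apply, fromBlocks_apply₂₂, Matrix.smul_apply,
        Matrix.one_apply, smul_eq_mul]
      change M i j = _
      rw [hD i j i.2 j.2]
      simp [Subtype.ext_iff]
  have hinv : ⅟ (d • (1 : Matrix (Sᶜ : Set V) (Sᶜ : Set V) ℝ)) = d⁻¹ • 1 := rfl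
  rw [← det_submatrix_equiv_self e M, hb, det_fromBlocks₂₂, hinv, det_smul, det_one, mul_one]
  congr! 2
  ext u v
  simp [Matrix.mul_apply, Finset.mul_sum]

end Schur

/-! ### The cofactor of a cycle is its length -/

section CycleDet

theorem fin_val_add_one {n : ℕ} (a : Fin (n + 3)) :
    (a + 1).val = if a.val = n + 2 then 0 else a.val + 1 := by
  split_ifs with h
  · have : a = Fin.last (n + 2) := Fin.ext h
    simp [this]
  · exact Fin.val_add_one_of_lt (Fin.lt_def.mpr (by simp; omega))

theorem fin_val_sub_one {n : ℕ} (a : Fin (n + 3)) :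
    (a - 1).val = if a.val = 0 then n + 2 else a.val - 1 := by
  rw [Fin.val_sub]
  have h1 : (1 : Fin (n + 3)).val = 1 := rfl
  rw [h1]
  split_ifs with h
  · rw [h, Nat.mod_eq_of_lt] <;> omega
  · rw [show n + 3 - 1 + a.val = (n + 3) + (a.val - 1) by omega, Nat.add_mod_left,
      Nat.mod_eq_of_lt]
    omega

theorem lapMatrix_cycleGraph_mulVec (n : ℕ) (z : Fin (n + 3) → ℝ) (a : Fin (n + 3)) :
    ((SimpleGraph.cycleGraph (n + 3)).lapMatrix ℝ).mulVec z a =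
      2 * z a - z (a - 1) - z (a + 1) := by
  have hne : a - 1 ≠ a + 1 := by
    intro h
    have := congrArg Fin.val h
    rw [fin_val_add_one, fin_val_sub_one] at this
    split_ifs at this <;> omega
  rw [SimpleGraph.lapMatrix_mulVec_apply, SimpleGraph.cycleGraph_degree_three_le,
    SimpleGraph.cycleGraph_neighborFinset, Finset.sum_pair hne]
  push_cast
  ring

theorem det_lapMatrix_cycleGraph_add_single (n : ℕ) :
    ((SimpleGraph.cycleGraph (n + 3)).lapMatrix ℝ +
      (Matrix.single 0 0 1 : Matrix (Fin (n + 3)) (Fin (n + 3)) ℝ)).det = ((n + 3 : ℕ) : ℝ) := by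
  set L := (SimpleGraph.cycleGraph (n + 3)).lapMatrix ℝ with hL
  -- Summation by parts: conjugating by the unipotent matrix of tail sums turns the path around the
  -- cycle into the identity and the closing edge into the rank-one term u uᵀ. The determinant is
  -- then 1 + |u|² = 1 + (n + 2).
  let Z : Matrix (Fin (n + 3)) (Fin (n + 3)) ℝ := Matrix.of fun i j => if i ≤ j then 1 else 0
  have hZ : Z.det = 1 := by
    rw [det_of_isUpperTriangular]
    · simp [Z]
    · intro i j hij
      exact if_neg (not_le.mpr hij)
  let u : Fin (n + 3) → ℝ := fun i => if i = 0 then 0 else 1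
  let E : Matrix (Fin (n + 3)) (Fin (n + 3)) ℝ := Matrix.single 0 0 1
  change (L + E).det = _
  have hY : ∀ a j, ((L + E) * Zᵀ) a j =
      if j = 0 then (if a = 0 then 1 else 0) else
        (if a = j then 1 else 0) - (if a = j - 1 then 1 else 0) +
          (if a = Fin.last (n + 2) then 1 else 0) - (if a = 0 then 1 else 0) := by
    intro a j
    have h1 : ((L + E) * Zᵀ) a j =
        L.mulVec (fun b => if j ≤ b then 1 else 0) a + if a = 0 ∧ j = 0 then 1 else 0 := by
      rw [add_mul, Matrix.add_apply]
      congr 1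
      by_cases ha : a = 0
      · subst ha; simp [Z, E]
      · simp [ha, E]
    rw [h1, hL, lapMatrix_cycleGraph_mulVec]
    simp only [Fin.le_def, Fin.ext_iff, fin_val_add_one, fin_val_sub_one, Fin.val_zero,
      Fin.val_last]
    have := a.2
    have := j.2
    split_ifs <;> first | omega | norm_num
  have hsum : ∀ i b : Fin (n + 3), ∑ a, Z i a * (if a = b then 1 else 0) =
      if i ≤ b then 1 else 0 := by
    intro i b; simp [Z]
  have key : Z * (L + E) * Zᵀ =
      1 + replicateCol Unit u * replicateRow Unit u := by
    ext i j
    rw [mul_assoc, Matrix.mul_apply]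
    simp only [hY]
    by_cases hj : j = 0
    · subst hj
      simp only [if_true, hsum]
      simp [Matrix.mul_apply, u, Matrix.one_apply]
    · simp only [hj, if_false, mul_add, mul_sub, Finset.sum_add_distrib, Finset.sum_sub_distrib,
        hsum]
      simp only [Matrix.add_apply, Matrix.one_apply, Matrix.mul_apply, replicateCol_apply,
        replicateRow_apply, u, hj, if_false, Finset.univ_unique, Finset.sum_singleton,
        Fin.le_last, if_true, mul_one]
      have hj0 : j.val ≠ 0 := fun h => hj (Fin.ext h)
      simp only [Fin.le_def, Fin.ext_iff, fin_val_sub_one, Fin.val_zero]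
      split_ifs <;> first | omega | norm_num
  have hdet := congrArg Matrix.det key
  rw [det_mul, det_mul, det_transpose, hZ, one_mul, mul_one,
    det_one_add_replicateCol_mul_replicateRow] at hdet
  rw [hdet]
  simp only [dotProduct, u, Fin.sum_univ_succ (n := n + 2)]
  simp
  ring

end CycleDet

/-! ### Connected 2-regular graphs are cycles -/

section TwoRegular

open SimpleGraph

variable {V : Type*} [Fintype V] {G : SimpleGraph V} [DecidableRel G.Adj]

/-- The edge count rules out a tree, so there is a copy of a cycle. Its edges already use both
neighbours of each of its vertices, so it is closed under adjacency, hence is everything. -/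
theorem exists_iso_cycleGraph (hG : G.Connected) (hdeg : ∀ v, G.degree v = 2) :
    ∃ m, 3 ≤ m ∧ Nonempty (cycleGraph m ≃g G) := by
  classical
  have hac : ¬ G.IsAcyclic := by
    intro h
    have h1 := (IsTree.mk hG h).card_edgeFinset
    have h2 := G.sum_degrees_eq_twice_card_edges
    simp only [hdeg, Finset.sum_const, Finset.card_univ, smul_eq_mul] at h2
    omega
  rw [isAcyclic_iff_free_cycleGraph] at hac
  push Not at hac
  obtain ⟨m, hm, hc⟩ := hac
  obtain ⟨f⟩ := hc
  obtain ⟨n, rfl⟩ : ∃ n, m = n + 3 := ⟨m - 3, by omega⟩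
  have hinj : Function.Injective f := f.injective
  have hnb : ∀ i w, G.Adj (f i) w → ∃ j, f j = w ∧ (cycleGraph (n + 3)).Adj i j := by
    intro i w hw
    have hsub : ((cycleGraph (n + 3)).neighborFinset i).image f ⊆ G.neighborFinset (f i) := by
      intro x hx
      obtain ⟨j, hj, rfl⟩ := Finset.mem_image.mp hx
      rw [mem_neighborFinset] at hj ⊢
      exact f.toHom.map_adj hj
    have heq := Finset.eq_of_subset_of_card_le hsub (by
      rw [Finset.card_image_of_injective _ hinj, card_neighborFinset_eq_degree,
        card_neighborFinset_eq_degree, hdeg, cycleGraph_degree_three_le])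
    have : w ∈ G.neighborFinset (f i) := (mem_neighborFinset _ _ _).mpr hw
    rw [← heq] at this
    obtain ⟨j, hj, rfl⟩ := Finset.mem_image.mp this
    exact ⟨j, rfl, (mem_neighborFinset _ _ _).mp hj⟩
  have hsurj : Function.Surjective f := by
    intro w
    obtain ⟨p⟩ := hG.preconnected (f 0) w
    have : ∀ {a b : V} (p : G.Walk a b), (∃ i, f i = a) → ∃ i, f i = b := by
      intro a b p
      induction p with
      | nil => exact id
      | cons hadj p ih =>
        rintro ⟨i, rfl⟩
        obtain ⟨j, hj, -⟩ := hnb i _ hadj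
        exact ih ⟨j, hj⟩
    exact this p ⟨0, rfl⟩
  refine ⟨n + 3, hm, ⟨⟨Equiv.ofBijective f ⟨hinj, hsurj⟩, ?_⟩⟩⟩
  intro a b
  constructor
  · intro h
    obtain ⟨j, hj, hadj⟩ := hnb a _ h
    rwa [← hinj hj]
  · intro h
    exact f.toHom.map_adj h

end TwoRegular

/-! ### Pruning leaves of a unicyclic graph -/

section Pruning

open SimpleGraph

/-- Every vertex of `T` has at least two neighbours inside `T`. -/
def IsTwoDense {V : Type*} (G : SimpleGraph V) (T : Set V) : Prop :=
  ∀ v ∈ T, ∃ a ∈ T, ∃ b ∈ T, a ≠ b ∧ G.Adj v a ∧ G.Adj v b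

theorem degree_induce_compl_singleton {V : Type*} [Fintype V] [DecidableEq V]
    (G : SimpleGraph V) [DecidableRel G.Adj] (x : V) (u : ({x}ᶜ : Set V))
    [Fintype ((G.induce ({x}ᶜ : Set V)).neighborSet u)] :
    (((G.induce ({x}ᶜ : Set V)).degree u : ℕ) : ℝ) =
      G.degree u - if G.Adj u x then 1 else 0 := by
  classical
  have h1 := degree_eq_sum_if_adj G (R := ℝ) u.1
  have h2 := degree_eq_sum_if_adj (G.induce ({x}ᶜ : Set V)) (R := ℝ) u
  have h3 := Fintype.sum_subtype_add_sum_subtype (fun j => j ∈ ({x}ᶜ : Set V))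
    (fun j => if G.Adj u.1 j then (1 : ℝ) else 0)
  have h4 : ∑ j : {j // ¬ j ∈ ({x}ᶜ : Set V)}, (if G.Adj u.1 j then (1 : ℝ) else 0) =
      if G.Adj u x then 1 else 0 := by
    rw [Fintype.sum_eq_single (⟨x, by simp⟩ : {j // ¬ j ∈ ({x}ᶜ : Set V)})]
    rintro ⟨j, hj⟩ hne
    exact absurd (Subtype.ext (by simpa using hj)) hne
  rw [h4] at h3
  simp only [comap_adj, Function.Embedding.subtype_apply] at h2
  rw [h1, ← h3, add_sub_cancel_right]
  refine Eq.trans ?_ (h2.trans ?_)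
  · congr!
  · congr!

/-- The diagonal entry at the leaf is 1, and its Schur complement subtracts 1 exactly at the
diagonal entry of its neighbour, which is the drop in that neighbour's degree. -/
theorem det_lapMatrix_add_single_of_degree_eq_one {V : Type*} [Fintype V] [DecidableEq V]
    (G : SimpleGraph V) [DecidableRel G.Adj] {x : V} (hx : G.degree x = 1)
    [Fintype ({x}ᶜ : Set V)] (r : ({x}ᶜ : Set V)) :
    (G.lapMatrix ℝ + Matrix.single r.1 r.1 1).det =
      ((G.induce ({x}ᶜ : Set V)).lapMatrix ℝ + Matrix.single r r 1).det := by
  have hrx : r.1 ≠ x := r.2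
  rw [det_eq_of_scalar_block _ ({x}ᶜ : Set V) one_ne_zero]
  · rw [one_pow, one_mul]
    obtain ⟨y, hy, huniq⟩ := degree_eq_one_iff_existsUnique_adj.mp hx
    have hs : ∀ g : (({x}ᶜᶜ : Set V)) → ℝ, ∑ j, g j = g ⟨x, by simp⟩ := by
      intro g
      rw [Fintype.sum_eq_single (⟨x, by simp⟩ : ({x}ᶜᶜ : Set V))]
      rintro ⟨j, hj⟩ hne
      exact absurd (Subtype.ext (by simpa using hj)) hne
    congr 1
    ext u v
    have hux : u.1 ≠ x := u.2
    have hvx : v.1 ≠ x := v.2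
    rw [Matrix.of_apply, hs]
    simp only [Matrix.add_apply, lapMatrix, degMatrix, Matrix.sub_apply, Matrix.diagonal_apply,
      adjMatrix_apply, Matrix.single_apply, hux, Ne.symm hvx, hrx, if_false, and_false,
      false_and, degree_induce_compl_singleton, Subtype.ext_iff, comap_adj,
      Function.Embedding.subtype_apply, G.adj_comm x v]
    by_cases huv : u.1 = v.1
    · rw [huv]
      by_cases hv : G.Adj v x <;> simp [hv]
      ring
    · by_cases h1 : G.Adj u x <;> by_cases h2 : G.Adj v x <;> simp [h1, h2, huv]
      exact huv ((huniq _ h1.symm).trans (huniq _ h2.symm).symm)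
  · intro a b ha hb
    obtain rfl : a = x := by simpa using ha
    obtain rfl : b = a := by simpa using hb
    simp [lapMatrix, degMatrix, hx, hrx]

/-- Removing leaves preserves connectedness, the equality of edges and vertices, and the cofactor,
and ends at a cycle. The clause on `IsTwoDense` sets makes the cycle the largest set of minimum
inner degree 2. It serves both for uniqueness of the cycle and for excluding triangles. -/
theorem exists_cycle_embedding (n : ℕ) : ∀ {V : Type*} [Fintype V] [DecidableEq V]
    (G : SimpleGraph V) [DecidableRel G.Adj], Fintype.card V = n → G.Connected →
    G.edgeFinset.card = Fintype.card V →
    ∃ m, 3 ≤ m ∧ ∃ f : cycleGraph m ↪g G,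
      (∀ T : Set V, IsTwoDense G T → T ⊆ Set.range f) ∧
      ∃ r ∈ Set.range f, (G.lapMatrix ℝ + Matrix.single r r 1).det = (m : ℝ) := by
  induction n with
  | zero =>
    intro V _ _ G _ hn hG _
    have := hG.nonempty
    exact absurd hn Fintype.card_ne_zero
  | succ n ih =>
    intro V _ _ G _ hn hG hE
    have := hG.nonempty
    have hsum := G.sum_degrees_eq_twice_card_edges
    by_cases hleaf : ∃ x, G.degree x = 1
    · obtain ⟨x, hx⟩ := hleaf
      have hG' := hG.induce_compl_singleton_of_degree_eq_one hx
      have hcard : Fintype.card ({x}ᶜ : Set V) = n := by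
        rw [Fintype.card_compl_set]; simp [hn]
      have hE' : (G.induce ({x}ᶜ : Set V)).edgeFinset.card = Fintype.card ({x}ᶜ : Set V) := by
        have h := G.card_edgeFinset_induce_compl_singleton x
        rw [card_edgeFinset_deleteIncidenceSet, hE, hx, hn] at h
        rw [hcard, ← Nat.add_sub_cancel (n := n) (m := 1), ← h]
      obtain ⟨m, hm, f, hT, r, ⟨i, hi⟩, hdet⟩ := ih _ hcard hG' hE'
      refine ⟨m, hm, f.trans (Embedding.induce _), ?_, r, ⟨i, by rw [← hi]; rfl⟩, ?_⟩
      · intro T hTd v hv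
        have hxT : ∀ w ∈ T, w ≠ x := by
          rintro w hw rfl
          obtain ⟨y, hy, huniq⟩ := degree_eq_one_iff_existsUnique_adj.mp hx
          obtain ⟨a, ha, b, hb, hab, h1, h2⟩ := hTd w hw
          exact hab ((huniq _ h1).trans (huniq _ h2).symm)
        have hd : IsTwoDense (G.induce ({x}ᶜ : Set V)) (Subtype.val ⁻¹' T) := by
          rintro ⟨w, hwx⟩ hw
          obtain ⟨a, ha, b, hb, hab, h1, h2⟩ := hTd w hw
          exact ⟨⟨a, hxT a ha⟩, ha, ⟨b, hxT b hb⟩, hb, fun h => hab (congrArg Subtype.val h),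
            h1, h2⟩
        obtain ⟨j, hj⟩ := hT _ hd (show (⟨v, hxT v hv⟩ : ({x}ᶜ : Set V)) ∈ _ from hv)
        exact ⟨j, congrArg Subtype.val hj⟩
      · rw [det_lapMatrix_add_single_of_degree_eq_one G hx, hdet]
    · push Not at hleaf
      have hnt : Nontrivial V := by
        rw [← not_subsingleton_iff_nontrivial]
        intro hs
        have : G.edgeFinset.card = 0 := by
          rw [Finset.card_eq_zero, edgeFinset_eq_empty]
          exact Subsingleton.elim _ _
        rw [hE] at this
        exact Fintype.card_ne_zero this
      have h2 : ∀ v, 2 ≤ G.degree v := by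
        intro v
        have h0 := hG.preconnected.degree_pos_of_nontrivial v
        have h1 := hleaf v
        omega
      -- All degrees are at least 2 and their average is 2.
      have hdeg : ∀ v, G.degree v = 2 := by
        have hs : ∑ v : V, 2 = ∑ v, G.degree v := by
          rw [hsum, hE]; simp [mul_comm]
        intro v
        exact ((Finset.sum_eq_sum_iff_of_le fun i _ => h2 i).mp hs v (Finset.mem_univ v)).symm
      obtain ⟨m, hm, ⟨φ⟩⟩ := exists_iso_cycleGraph hG hdeg
      obtain ⟨k, rfl⟩ : ∃ k, m = k + 3 := ⟨m - 3, by omega⟩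
      refine ⟨k + 3, hm, φ.toEmbedding, fun T _ v _ => φ.surjective v, φ 0, ⟨0, rfl⟩, ?_⟩
      rw [← det_lapMatrix_cycleGraph_add_single k, ← det_submatrix_equiv_self φ.toEquiv]
      congr 1
      ext a b
      simp only [submatrix_apply, Matrix.add_apply, lapMatrix, degMatrix, Matrix.sub_apply,
        Matrix.diagonal_apply, adjMatrix_apply, Matrix.single_apply]
      have e1 : φ.toEquiv a = φ.toEquiv b ↔ a = b := φ.toEquiv.injective.eq_iff
      have e2 : G.Adj (φ.toEquiv a) (φ.toEquiv b) ↔ (cycleGraph (k + 3)).Adj a b :=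
        φ.map_rel_iff
      have e3 : ∀ c, φ 0 = φ.toEquiv c ↔ 0 = c := fun c => φ.injective.eq_iff
      simp only [e1, e2, e3, hdeg, cycleGraph_degree_three_le]

end Pruning

/-! ### Eliminating the leaves of a sun-like graph -/

section SunLike

open SimpleGraph

theorem mem_of_connected_of_closed {V : Type*} {G : SimpleGraph V} (hG : G.Connected) {S : Set V}
    (hne : S.Nonempty) (hS : ∀ a ∈ S, ∀ b, G.Adj a b → b ∈ S) (v : V) : v ∈ S := by
  obtain ⟨a, ha⟩ := hne
  obtain ⟨p⟩ := hG.preconnected a v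
  induction p with
  | nil => exact ha
  | cons h p ih => exact ih (hS _ ha _ h)

variable {V : Type*} [Fintype V] {G : SimpleGraph V} [DecidableRel G.Adj]

theorem degree_ne_one_of_adj_of_degree_eq_one (hG : G.Connected) {w : V} (hw : G.degree w ≠ 1)
    {x y : V} (hx : G.degree x = 1) (hxy : G.Adj x y) : G.degree y ≠ 1 := by
  intro hy
  have hmem := mem_of_connected_of_closed hG (S := {x, y}) ⟨x, by simp⟩ (by
    intro a ha b hab
    obtain ⟨x', hx', hux⟩ := degree_eq_one_iff_existsUnique_adj.mp hx
    obtain ⟨y', hy', huy⟩ := degree_eq_one_iff_existsUnique_adj.mp hy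
    simp only [Set.mem_insert_iff, Set.mem_singleton_iff] at ha ⊢
    rcases ha with rfl | rfl
    · right; exact (hux _ hab).trans (hux _ hxy).symm
    · left; exact (huy _ hab).trans (huy _ hxy.symm).symm) w
  rcases hmem with rfl | rfl <;> contradiction

theorem degree_core_eq {n : ℕ} (φ : cycleGraph (n + 3) ≃g core G) (i : Fin (n + 3)) :
    (G.degree (φ i).1 : ℝ) = 2 + ∑ l : ({v : V | G.degree v ≠ 1}ᶜ : Set V),
      if G.Adj (φ i).1 l then (1 : ℝ) else 0 := by
  have h1 := degree_eq_sum_if_adj G (R := ℝ) (φ i).1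
  have h2 := degree_eq_sum_if_adj (core G) (R := ℝ) (φ i)
  have h3 := Fintype.sum_subtype_add_sum_subtype (fun j => j ∈ {v : V | G.degree v ≠ 1})
    (fun j => if G.Adj (φ i).1 j then (1 : ℝ) else 0)
  have h4 : (core G).degree (φ i) = 2 := by
    rw [← cycleGraph_degree_three_le (n := n) (v := i)]
    exact φ.degree_eq i
  rw [h4] at h2
  rw [h1, ← h3]
  congr 1
  push_cast at h2
  rw [h2]
  refine Finset.sum_congr (by congr!) fun l _ => ?_
  simp only [comap_adj, Function.Embedding.subtype_apply]

/-- Leaves are pairwise non-adjacent, so their block of x - L is (x - 1) times the identity. Each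
leaf has one neighbour and therefore corrects only a diagonal entry, by 1/(x - 1). With c leaves at
a vertex, x - 2 - c - c/(x - 1) = x - 2 - c·x/(x - 1). -/
theorem eval_charpoly_lapMatrix_of_core_iso [DecidableEq V] (hG : G.Connected) {n : ℕ}
    (φ : cycleGraph (n + 3) ≃g core G) {x : ℝ} (hx : x ≠ 1) :
    (G.lapMatrix ℝ).charpoly.eval x =
      (x - 1) ^ (Fintype.card V - (n + 3)) * (Matrix.of fun i j : Fin (n + 3) =>
        (if i = j then x - 2 - ((G.degree (φ i).1 : ℝ) - 2) * (x / (x - 1)) else 0) +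
          if (cycleGraph (n + 3)).Adj i j then (1 : ℝ) else 0).det := by
  have hx1 : x - 1 ≠ 0 := sub_ne_zero.mpr hx
  have hcard : Fintype.card ({v : V | G.degree v ≠ 1}ᶜ : Set V) =
      Fintype.card V - (n + 3) := by
    rw [Fintype.card_compl_set, ← Fintype.card_congr φ.toEquiv, Fintype.card_fin]
  rw [eval_charpoly, det_eq_of_scalar_block _ {v : V | G.degree v ≠ 1} hx1, hcard]
  · congr 1
    rw [← det_submatrix_equiv_self φ.toEquiv]
    congr 1
    ext i j
    have e1 : (φ i).1 = (φ j).1 ↔ i = j := by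
      rw [← Subtype.ext_iff, φ.injective.eq_iff]
    have e2 : G.Adj (φ i).1 (φ j).1 ↔ (cycleGraph (n + 3)).Adj i j := φ.map_rel_iff
    have e3 : ∀ (k : Fin (n + 3)) (l : ({v : V | G.degree v ≠ 1}ᶜ : Set V)),
        (φ k).1 ≠ l.1 := fun k l h => l.2 (h ▸ (φ k).2)
    simp only [submatrix_apply, Matrix.of_apply, Matrix.sub_apply, lapMatrix, degMatrix,
      scalar_apply, Matrix.diagonal_apply, adjMatrix_apply]
    change (if (φ i).1 = (φ j).1 then x else 0) - ((if (φ i).1 = (φ j).1 then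
      (G.degree (φ i).1 : ℝ) else 0) - if G.Adj (φ i).1 (φ j).1 then 1 else 0) - (x - 1)⁻¹ *
      ∑ l : ({v : V | G.degree v ≠ 1}ᶜ : Set V), ((if (φ i).1 = l.1 then x else 0) -
        ((if (φ i).1 = l.1 then (G.degree (φ i).1 : ℝ) else 0) -
          if G.Adj (φ i).1 l then 1 else 0)) * ((if l.1 = (φ j).1 then x else 0) -
        ((if l.1 = (φ j).1 then (G.degree l.1 : ℝ) else 0) -
          if G.Adj l.1 (φ j).1 then 1 else 0)) = _
    have e4 : ∀ (k : Fin (n + 3)) (l : ({v : V | G.degree v ≠ 1}ᶜ : Set V)),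
        l.1 ≠ (φ k).1 := fun k l h => e3 k l h.symm
    simp only [e1, e2, e3, e4, if_false, zero_sub, neg_neg]
    by_cases hij : i = j
    · subst hij
      have hd := degree_core_eq φ i
      have hs : ∑ l : ({v : V | G.degree v ≠ 1}ᶜ : Set V),
          (if G.Adj (φ i).1 l then (1 : ℝ) else 0) * (if G.Adj l.1 (φ i).1 then 1 else 0) =
          G.degree (φ i).1 - 2 := by
        rw [hd, add_sub_cancel_left]
        refine Finset.sum_congr rfl fun l _ => ?_
        by_cases h : G.Adj (φ i).1 l
        · simp [h, h.symm]
        · simp [h]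
      rw [hs]
      simp only [if_true, SimpleGraph.irrefl, if_false]
      field_simp
      ring
    · have hs : ∑ l : ({v : V | G.degree v ≠ 1}ᶜ : Set V),
          (if G.Adj (φ i).1 l then (1 : ℝ) else 0) * (if G.Adj l.1 (φ j).1 then 1 else 0) = 0 := by
        refine Finset.sum_eq_zero fun l _ => ?_
        by_cases h1 : G.Adj (φ i).1 l <;> by_cases h2 : G.Adj l.1 (φ j).1 <;> simp [h1, h2]
        obtain ⟨y, hy, huniq⟩ := degree_eq_one_iff_existsUnique_adj.mp (not_not.mp l.2)
        exact hij (e1.mp ((huniq _ h1.symm).trans (huniq _ h2).symm))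
      rw [hs]
      simp [hij]
  · intro a b ha hb
    have ha' : G.degree a = 1 := not_not.mp ha
    have hb' : G.degree b = 1 := not_not.mp hb
    have hab : ¬ G.Adj a b := fun h =>
      degree_ne_one_of_adj_of_degree_eq_one hG (φ 0).2 ha' h hb'
    by_cases h : a = b
    · subst h
      simp [lapMatrix, degMatrix, ha']
    · simp [lapMatrix, degMatrix, h, hab]

end SunLike

/-! ### Passing to the variable q through the cycle's Green's function -/

section HubMatrix

/-- The reduced cycle matrix obtained from `x - L` by eliminating the leaves, where `c i` leaves are
attached to the vertex `i` of the cycle. -/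
noncomputable def reducedMatrix {n : ℕ} (c : Fin (n + 3) → ℕ) (x : ℝ) :
    Matrix (Fin (n + 3)) (Fin (n + 3)) ℝ :=
  Matrix.of fun i j => (if i = j then x - 2 - (c i : ℝ) * (x / (x - 1)) else 0) +
    if (SimpleGraph.cycleGraph (n + 3)).Adj i j then (1 : ℝ) else 0

/-- The diagonal entry of `hubMatrix` at a vertex with `a` leaves. -/
noncomputable def hubDiag (n a : ℕ) : ℝ[X] :=
  (1 + X ^ 3) * (1 - X ^ (n + 3)) + X * (1 - X) * (a : ℝ[X]) * (1 + X ^ (n + 3))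

/-- The product of `reducedMatrix` at `x = 2 - q - q⁻¹` with the Green's function of the cycle,
rescaled so as to have polynomial entries in `q`. -/
noncomputable def hubMatrix {n : ℕ} (c : Fin (n + 3) → ℕ) :
    Matrix (Fin (n + 3)) (Fin (n + 3)) ℝ[X] :=
  Matrix.of fun u v => if u = v then hubDiag n (c u) else
    X * (1 - X) * (c u : ℝ[X]) * (X ^ (v - u).val + X ^ (u - v).val)

theorem fin_val_sub_rev {n : ℕ} {u v : Fin (n + 3)} (h : u ≠ v) :
    (u - v).val = n + 3 - (v - u).val := by
  have h1 : u.val ≠ v.val := fun h' => h (Fin.ext h')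
  have hu := u.2
  have hv := v.2
  rcases lt_or_gt_of_ne h1 with h2 | h2
  · rw [Fin.coe_sub_iff_lt.mpr h2, Fin.coe_sub_iff_le.mpr (le_of_lt h2)]; omega
  · rw [Fin.coe_sub_iff_lt.mpr h2, Fin.coe_sub_iff_le.mpr (le_of_lt h2)]; omega

/-- The Green's function of the cycle of length `n + 3`, up to scaling. -/
noncomputable def cycleGreen (n : ℕ) (q : ℝ) (d : Fin (n + 3)) : ℝ :=
  q ^ d.val + q ^ (n + 3 - d.val)

/-- The powers of q and of 1/q solve the homogeneous recurrence. Their combination here takes the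
same value at 0 and at n + 3, so it closes up around the cycle with a source only at 0. -/
theorem cycleGreen_recurrence {n : ℕ} {q : ℝ} (hq : q ≠ 0) (d : Fin (n + 3)) :
    (q + q⁻¹) * cycleGreen n q d - cycleGreen n q (d - 1) - cycleGreen n q (d + 1) =
      if d = 0 then (q⁻¹ - q) * (1 - q ^ (n + 3)) else 0 := by
  obtain ⟨m, hm⟩ := d
  unfold cycleGreen
  rw [fin_val_add_one, fin_val_sub_one]
  simp only [Fin.ext_iff, Fin.val_zero]
  rcases Nat.eq_zero_or_pos m with rfl | hpos
  · simp only [if_true, show ¬ (0 = n + 2) by omega, if_false]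
    rw [show n + 3 - (n + 2) = 1 by omega, show n + 3 - (0 + 1) = n + 2 by omega]
    field_simp
    simp only [Nat.sub_zero]
    ring
  · obtain ⟨a, rfl⟩ : ∃ a, m = a + 1 := ⟨m - 1, by omega⟩
    simp only [show ¬ (a + 1 = 0) by omega, if_false, Nat.add_sub_cancel]
    rcases eq_or_ne (a + 1) (n + 2) with h | h
    · obtain rfl : a = n + 1 := by omega
      simp only [if_true]
      rw [show n + 3 - (n + 1 + 1) = 1 by omega, show n + 3 - (n + 1) = 2 by omega]
      field_simp
      simp only [Nat.sub_zero]
      ring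
    · obtain ⟨b, rfl⟩ : ∃ b, n = a + b := ⟨n - a, by omega⟩
      simp only [h, if_false]
      rw [show a + b + 3 - (a + 1) = b + 2 by omega, show a + b + 3 - a = b + 3 by omega,
        show a + b + 3 - (a + 1 + 1) = b + 1 by omega]
      field_simp
      ring

theorem sum_adj_cycleGraph {n : ℕ} (u : Fin (n + 3)) (g : Fin (n + 3) → ℝ) :
    ∑ w, (if (SimpleGraph.cycleGraph (n + 3)).Adj u w then (1 : ℝ) else 0) * g w =
      g (u - 1) + g (u + 1) := by
  have h := lapMatrix_cycleGraph_mulVec n g u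
  rw [SimpleGraph.lapMatrix_mulVec_apply, SimpleGraph.cycleGraph_degree_three_le] at h
  have h2 : ∑ w, (if (SimpleGraph.cycleGraph (n + 3)).Adj u w then (1 : ℝ) else 0) * g w =
      ∑ w ∈ (SimpleGraph.cycleGraph (n + 3)).neighborFinset u, g w := by
    rw [SimpleGraph.neighborFinset_eq_filter, Finset.sum_filter]
    simp
  rw [h2]
  push_cast at h
  linarith

/-- At x = 2 - q - 1/q the hub-free part of `-reducedMatrix` is the operator inverted by the Green's
function, so it contributes only on the diagonal; a hub multiplies its row of the Green's function
by its weight. The scalar clears denominators, since x/(x - 1) = (1 - q)²/(1 - q + q²) and 1 + q³ =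
(1 + q)(1 - q + q²). -/
theorem hubMatrix_eval_eq {n : ℕ} (c : Fin (n + 3) → ℕ) {q : ℝ} (h0 : 0 < q) (h1 : q < 1) :
    (hubMatrix c).map (Polynomial.eval q) = (q * (1 + q ^ 3) / (1 - q ^ 2)) •
      (-(reducedMatrix c (2 - q - q⁻¹)) * Matrix.of fun u v => cycleGreen n q (v - u)) := by
  have hq2 : (1 - q ^ 2) ≠ 0 := by nlinarith
  have hx : (2 - q - q⁻¹ - 1) ≠ 0 := by
    have : 1 < q⁻¹ := (one_lt_inv₀ h0).mpr h1
    intro h; linarith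
  have hden : 1 - q + q ^ 2 ≠ 0 := by nlinarith [sq_nonneg (q - 1)]
  have ht : q * (1 + q ^ 3) / (1 - q ^ 2) * ((2 - q - q⁻¹) / (2 - q - q⁻¹ - 1)) =
      q * (1 - q) := by
    have e : (2 - q - q⁻¹) / (2 - q - q⁻¹ - 1) = (1 - q) ^ 2 / (1 - q + q ^ 2) := by
      rw [div_eq_div_iff hx hden]
      field_simp
      ring
    rw [e]
    field_simp
    ring
  have hs : q * (1 + q ^ 3) / (1 - q ^ 2) * ((q⁻¹ - q) * (1 - q ^ (n + 3))) =
      (1 + q ^ 3) * (1 - q ^ (n + 3)) := by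
    field_simp
  set s := q * (1 + q ^ 3) / (1 - q ^ 2) with hsdef
  set t := (2 - q - q⁻¹) / (2 - q - q⁻¹ - 1) with htdef
  ext u v
  have hmul : (-(reducedMatrix c (2 - q - q⁻¹)) * Matrix.of fun u v => cycleGreen n q (v - u)) u v
      = (q + q⁻¹ + (c u : ℝ) * t) * cycleGreen n q (v - u) - cycleGreen n q (v - u - 1) -
        cycleGreen n q (v - u + 1) := by
    rw [Matrix.mul_apply]
    simp only [Matrix.neg_apply, reducedMatrix, Matrix.of_apply, neg_mul, add_mul,
      Finset.sum_neg_distrib, Finset.sum_add_distrib, sum_adj_cycleGraph]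
    rw [Finset.sum_eq_single u (fun w _ hw => by simp [Ne.symm hw]) (by simp)]
    rw [show v - (u - 1) = v - u + 1 by abel, show v - (u + 1) = v - u - 1 by abel]
    simp only [if_true, ← htdef]
    ring
  rw [Matrix.smul_apply, smul_eq_mul, hmul]
  have hrec := cycleGreen_recurrence (n := n) h0.ne' (v - u)
  have hrw : s * ((q + q⁻¹ + (c u : ℝ) * t) * cycleGreen n q (v - u) -
      cycleGreen n q (v - u - 1) - cycleGreen n q (v - u + 1)) =
      s * (if v - u = 0 then (q⁻¹ - q) * (1 - q ^ (n + 3)) else 0) +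
        (s * t) * (c u : ℝ) * cycleGreen n q (v - u) := by
    rw [← hrec]; ring
  rw [hrw, ht, Matrix.map_apply, hubMatrix, Matrix.of_apply]
  by_cases huv : u = v
  · subst huv
    rw [if_pos rfl, sub_self, if_pos rfl, hs]
    simp [hubDiag, cycleGreen]
  · have hvu : v - u ≠ 0 := fun h => huv (sub_eq_zero.mp h).symm
    rw [if_neg huv, if_neg hvu, fin_val_sub_rev huv]
    simp [cycleGreen]

/-- The scalar and the Green's matrix do not depend on the hubs, so the determinants agree at every
q in (0, 1), hence as polynomials. Invertibility of the Green's matrix is not needed. -/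
theorem det_hubMatrix_eq {n : ℕ} {c c' : Fin (n + 3) → ℕ}
    (h : ∀ x : ℝ, x ≠ 1 → (reducedMatrix c x).det = (reducedMatrix c' x).det) :
    (hubMatrix c).det = (hubMatrix c').det := by
  have hev : ∀ q : ℝ, 0 < q → q < 1 →
      (hubMatrix c).det.eval q = (hubMatrix c').det.eval q := by
    intro q h0 h1
    have hx : 2 - q - q⁻¹ ≠ 1 := by
      have : 1 < q⁻¹ := (one_lt_inv₀ h0).mpr h1
      intro h; linarith
    have e : ∀ c : Fin (n + 3) → ℕ, (hubMatrix c).det.eval q =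
        ((hubMatrix c).map (Polynomial.eval q)).det := fun c =>
      (Polynomial.evalRingHom q).map_det (hubMatrix c)
    rw [e, e, hubMatrix_eval_eq c h0 h1, hubMatrix_eval_eq c' h0 h1, det_smul, det_smul, det_mul,
      det_mul, det_neg, det_neg, h _ hx]
  refine Polynomial.eq_of_infinite_eval_eq _ _ ((Set.Ioo_infinite (zero_lt_one' ℝ)).mono ?_)
  intro q hq
  exact hev q hq.1 hq.2

end HubMatrix

/-! ### Leibniz expansion up to transpositions -/

section Leibniz

variable {ι R : Type*} [Fintype ι] [DecidableEq ι] [CommRing R]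

theorem prod_swap_apply (M : Matrix ι ι R) {u v : ι} (h : u ≠ v) :
    ∏ i, M (Equiv.swap u v i) i =
      M u v * M v u * ∏ w ∈ (Finset.univ.erase u).erase v, M w w := by
  rw [← Finset.mul_prod_erase Finset.univ _ (Finset.mem_univ u),
    ← Finset.mul_prod_erase (Finset.univ.erase u) _
      (Finset.mem_erase.mpr ⟨h.symm, Finset.mem_univ v⟩),
    Equiv.swap_apply_left, Equiv.swap_apply_right, ← mul_assoc, mul_comm (M v u)]
  congr 1
  refine Finset.prod_congr rfl fun w hw => ?_
  rw [Equiv.swap_apply_of_ne_of_ne]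
  · exact Finset.ne_of_mem_erase (Finset.mem_of_mem_erase hw)
  · exact Finset.ne_of_mem_erase hw

theorem sum_offDiag_swap (g : Equiv.Perm ι → R) :
    ∑ p ∈ (Finset.univ : Finset ι).offDiag, g (Equiv.swap p.1 p.2) =
      2 * ∑ σ : Equiv.Perm ι with σ.support.card = 2, g σ := by
  rw [← Finset.sum_fiberwise_of_maps_to (s := (Finset.univ : Finset ι).offDiag)
    (t := Finset.univ.filter fun σ : Equiv.Perm ι => σ.support.card = 2)
    (g := fun p => Equiv.swap p.1 p.2), Finset.mul_sum]
  · refine Finset.sum_congr rfl fun σ hσ => ?_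
    rw [Finset.sum_congr rfl (g := fun _ => g σ)
      (fun p hp => by rw [(Finset.mem_filter.mp hp).2])]
    obtain ⟨a, b, hab, rfl⟩ := Equiv.Perm.card_support_eq_two.mp (Finset.mem_filter.mp hσ).2
    have hset : (Finset.univ : Finset ι).offDiag.filter
        (fun p => Equiv.swap p.1 p.2 = Equiv.swap a b) = {(a, b), (b, a)} := by
      ext ⟨x, y⟩
      simp only [Finset.mem_filter, Finset.mem_offDiag, Finset.mem_univ, true_and,
        Finset.mem_insert, Finset.mem_singleton, Prod.mk.injEq]
      constructor
      · rintro ⟨hxy, h⟩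
        have h1 := congrArg Equiv.Perm.support h
        rw [Equiv.Perm.support_swap hxy, Equiv.Perm.support_swap hab] at h1
        have hx : x = a ∨ x = b := by
          have : x ∈ ({x, y} : Finset ι) := by simp
          rw [h1] at this; simpa using this
        have hy : y = a ∨ y = b := by
          have : y ∈ ({x, y} : Finset ι) := by simp
          rw [h1] at this; simpa using this
        rcases hx with rfl | rfl <;> rcases hy with rfl | rfl <;> simp_all
      · rintro (⟨rfl, rfl⟩ | ⟨rfl, rfl⟩)
        · exact ⟨hab, rfl⟩
        · exact ⟨hab.symm, Equiv.swap_comm _ _⟩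
    rw [hset, Finset.sum_const, Finset.card_pair (by simp [hab])]
    simp
  · intro p hp
    simp only [Finset.mem_filter, Finset.mem_univ, true_and]
    rw [Equiv.Perm.card_support_eq_two]
    exact ⟨p.1, p.2, (Finset.mem_offDiag.mp hp).2.2, rfl⟩

/-- No permutation moves exactly one point, so only the identity and the transpositions lie outside
the hypothesis on z. The factor 2 comes from writing each transposition as two ordered pairs. -/
theorem dvd_two_mul_det_sub (M : Matrix ι ι R) (z : R)
    (hz : ∀ σ : Equiv.Perm ι, 3 ≤ σ.support.card → z ∣ ∏ i, M (σ i) i) :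
    z ∣ 2 * M.det - (2 * ∏ i, M i i - ∑ p ∈ (Finset.univ : Finset ι).offDiag,
      M p.1 p.2 * M p.2 p.1 * ∏ w ∈ (Finset.univ.erase p.1).erase p.2, M w w) := by
  let g : Equiv.Perm ι → R := fun σ => Equiv.Perm.sign σ • ∏ i, M (σ i) i
  have hdet : M.det = ∑ σ, g σ := det_apply M
  have hsplit : ∑ σ, g σ = ∑ σ : Equiv.Perm ι with σ.support.card = 0, g σ +
      ∑ σ : Equiv.Perm ι with σ.support.card = 2, g σ +
      ∑ σ : Equiv.Perm ι with 3 ≤ σ.support.card, g σ := by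
    simp only [Finset.sum_filter, ← Finset.sum_add_distrib]
    refine Finset.sum_congr rfl fun σ _ => ?_
    have h1 : σ.support.card ≠ 1 := Equiv.Perm.card_support_ne_one σ
    by_cases h0 : σ.support.card = 0
    · simp [h0]
    · by_cases h2 : σ.support.card = 2
      · simp [h2]
      · have h3 : 3 ≤ σ.support.card := by omega
        simp [h0, h2, h3]
  have hone : ∑ σ : Equiv.Perm ι with σ.support.card = 0, g σ = ∏ i, M i i := by
    rw [Finset.sum_eq_single 1]
    · simp [g]
    · intro σ hσ hne
      rw [Finset.mem_filter, Equiv.Perm.card_support_eq_zero] at hσ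
      exact absurd hσ.2 hne
    · simp
  have hswap : 2 * ∑ σ : Equiv.Perm ι with σ.support.card = 2, g σ =
      - ∑ p ∈ (Finset.univ : Finset ι).offDiag,
        M p.1 p.2 * M p.2 p.1 * ∏ w ∈ (Finset.univ.erase p.1).erase p.2, M w w := by
    rw [← sum_offDiag_swap, ← Finset.sum_neg_distrib]
    refine Finset.sum_congr rfl fun p hp => ?_
    have hne := (Finset.mem_offDiag.mp hp).2.2
    simp only [g]
    rw [prod_swap_apply M hne, Equiv.Perm.sign_swap hne]
    simp
  have hrest : z ∣ ∑ σ : Equiv.Perm ι with 3 ≤ σ.support.card, g σ := by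
    refine Finset.dvd_sum fun σ hσ => ?_
    obtain ⟨y, hy⟩ := hz σ (Finset.mem_filter.mp hσ).2
    refine ⟨Equiv.Perm.sign σ • y, ?_⟩
    simp only [g]
    rw [hy, mul_smul_comm]
  rw [hdet, hsplit, hone, mul_add, mul_add, hswap]
  have e : ∀ a b c : R, a + -b + c - (a - b) = c := fun a b c => by ring
  rw [e]
  exact Dvd.dvd.mul_left hrest 2

end Leibniz

/-! ### The transposition terms as a generating function of hub distances -/

section HubExpansion

variable {n : ℕ}

/-- Any two vertices of the support of `c` are at distance at least `D` on the cycle. -/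
def IsSeparated (D : ℕ) (c : Fin (n + 3) → ℕ) : Prop :=
  ∀ u v, u ≠ v → c u ≠ 0 → c v ≠ 0 → D ≤ (v - u).val

/-- Each of the at least three moved indices contributes an off-diagonal entry divisible by X^(D+1).
If some moved index is not a hub, its row has no off-diagonal entries and the product vanishes. -/
theorem dvd_prod_hubMatrix {D : ℕ} {c : Fin (n + 3) → ℕ} (hc : IsSeparated D c)
    (σ : Equiv.Perm (Fin (n + 3))) (hσ : 3 ≤ σ.support.card) :
    (X : ℝ[X]) ^ (3 * D + 3) ∣ ∏ i, hubMatrix c (σ i) i := by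
  refine dvd_trans ?_ (Finset.prod_dvd_prod_of_subset _ _ _ (Finset.subset_univ σ.support))
  by_cases h : ∀ i ∈ σ.support, c i ≠ 0
  · have h1 : ∏ _i ∈ σ.support, (X : ℝ[X]) ^ (D + 1) ∣ ∏ i ∈ σ.support, hubMatrix c (σ i) i := by
      refine Finset.prod_dvd_prod_of_dvd _ _ fun i hi => ?_
      have hne : σ i ≠ i := Equiv.Perm.mem_support.mp hi
      have hci := h i hi
      have hcs := h (σ i) (Equiv.Perm.apply_mem_support.mpr hi)
      rw [hubMatrix, Matrix.of_apply, if_neg hne, pow_succ']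
      have h2 : (X : ℝ[X]) ^ D ∣ X ^ (i - σ i).val + X ^ (σ i - i).val :=
        dvd_add (pow_dvd_pow _ (hc _ _ hne hcs hci)) (pow_dvd_pow _ (hc _ _ hne.symm hci hcs))
      exact mul_dvd_mul (Dvd.dvd.mul_right (dvd_mul_right _ _) _) h2
    rw [Finset.prod_const, ← pow_mul] at h1
    refine (pow_dvd_pow _ ?_).trans h1
    nlinarith
  · push Not at h
    obtain ⟨i, hi, hci⟩ := h
    have : ∏ i ∈ σ.support, hubMatrix c (σ i) i = 0 := by
      refine Finset.prod_eq_zero (i := σ⁻¹ i) ?_ ?_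
      · rw [← Equiv.Perm.apply_mem_support]
        simpa using hi
      · have hne : σ (σ⁻¹ i) ≠ σ⁻¹ i := by
          have : σ⁻¹ i ∈ σ.support := by
            rw [← Equiv.Perm.apply_mem_support]; simpa using hi
          exact Equiv.Perm.mem_support.mp this
        rw [hubMatrix, Matrix.of_apply, if_neg hne]
        simp [hci]
    rw [this]
    exact dvd_zero _

/-- The number of ordered pairs at clockwise distance `d` with product of weights `m`. -/
def pairCount (c : Fin (n + 3) → ℕ) (m d : ℕ) : ℕ :=
  ((Finset.univ : Finset (Fin (n + 3))).offDiag.filter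
    fun p => (p.2 - p.1).val = d ∧ c p.1 * c p.2 = m).card

/-- Squaring X^d + X^(n+3-d) gives the two clockwise distances of a pair, merged by swapping the
pair, and a cross term of order n + 3, too high to matter later. -/
theorem sum_offDiag_hubMatrix (c : Fin (n + 3) → ℕ) :
    ∃ y : ℝ[X], ∑ p ∈ (Finset.univ : Finset (Fin (n + 3))).offDiag,
      hubMatrix c p.1 p.2 * hubMatrix c p.2 p.1 *
        ∏ w ∈ (Finset.univ.erase p.1).erase p.2, hubMatrix c w w =
      2 * ∑ p ∈ (Finset.univ : Finset (Fin (n + 3))).offDiag,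
        X ^ 2 * (1 - X) ^ 2 * ((c p.1 * c p.2 : ℕ) : ℝ[X]) *
        (∏ w ∈ (Finset.univ.erase p.1).erase p.2, hubDiag n (c w)) * X ^ (2 * (p.2 - p.1).val) +
      X ^ (n + 3) * y := by
  let E : Fin (n + 3) × Fin (n + 3) → ℝ[X] := fun p =>
    X ^ 2 * (1 - X) ^ 2 * ((c p.1 * c p.2 : ℕ) : ℝ[X]) *
        ∏ w ∈ (Finset.univ.erase p.1).erase p.2, hubDiag n (c w)
  have hE : ∀ p, E p.swap = E p := by
    intro p
    simp only [E, Prod.fst_swap, Prod.snd_swap]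
    rw [Finset.erase_right_comm, mul_comm (c p.2)]
  refine ⟨∑ p ∈ (Finset.univ : Finset (Fin (n + 3))).offDiag, 2 * E p, ?_⟩
  have hterm : ∀ p ∈ (Finset.univ : Finset (Fin (n + 3))).offDiag,
      hubMatrix c p.1 p.2 * hubMatrix c p.2 p.1 *
        ∏ w ∈ (Finset.univ.erase p.1).erase p.2, hubMatrix c w w =
      E p * X ^ (2 * (p.2 - p.1).val) + E p * X ^ (2 * (p.1 - p.2).val) +
        X ^ (n + 3) * (2 * E p) := by
    intro p hp
    have hne := (Finset.mem_offDiag.mp hp).2.2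
    have hd : (p.1 - p.2).val + (p.2 - p.1).val = n + 3 := by
      have := fin_val_sub_rev hne
      have := (p.2 - p.1).2
      omega
    have hdiag : ∀ w, hubMatrix c w w = hubDiag n (c w) := fun w => by simp [hubMatrix]
    simp only [hdiag]
    simp only [hubMatrix, Matrix.of_apply, if_neg hne, if_neg hne.symm, E, ← hd]
    push_cast
    ring
  rw [Finset.sum_congr rfl hterm, Finset.sum_add_distrib, Finset.sum_add_distrib,
    ← Finset.mul_sum _ _ ((X : ℝ[X]) ^ (n + 3))]
  congr 1
  have hsym : ∑ p ∈ (Finset.univ : Finset (Fin (n + 3))).offDiag, E p * X ^ (2 * (p.1 - p.2).val) =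
      ∑ p ∈ (Finset.univ : Finset (Fin (n + 3))).offDiag, E p * X ^ (2 * (p.2 - p.1).val) := by
    refine Finset.sum_nbij' Prod.swap Prod.swap ?_ ?_ (fun _ _ => rfl) (fun _ _ => rfl) ?_
    · intro p hp
      simpa [eq_comm] using hp
    · intro p hp
      simpa [eq_comm] using hp
    · intro p _
      rw [hE]
      rfl
  rw [hsym, ← two_mul]

/-- The product over the vertices off a pair is the full product divided by two diagonal entries.
Multiplying by `hubDiag n 1 * hubDiag n 2 ^ 2` makes the quotient polynomial: a pair of weights 1, 2
leaves `hubDiag n 2`, and a pair 2, 2 leaves `hubDiag n 1`. -/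
theorem sum_offDiag_hubDiag {c : Fin (n + 3) → ℕ} (h2 : ∀ u, c u ≤ 2)
    (h1 : ∀ u v, c u = 1 → c v = 1 → u = v) :
    hubDiag n 1 * hubDiag n 2 ^ 2 * ∑ p ∈ (Finset.univ : Finset (Fin (n + 3))).offDiag,
        X ^ 2 * (1 - X) ^ 2 * ((c p.1 * c p.2 : ℕ) : ℝ[X]) *
        (∏ w ∈ (Finset.univ.erase p.1).erase p.2, hubDiag n (c w)) * X ^ (2 * (p.2 - p.1).val) =
      X ^ 2 * ((1 - X) ^ 2 * (∏ w, hubDiag n (c w)) * ∑ d ∈ Finset.range (n + 3),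
        X ^ (2 * d) * (2 * (pairCount c 2 d : ℝ[X]) * hubDiag n 2 +
          4 * (pairCount c 4 d : ℝ[X]) * hubDiag n 1)) := by
  have hterm : ∀ p ∈ (Finset.univ : Finset (Fin (n + 3))).offDiag,
      hubDiag n 1 * hubDiag n 2 ^ 2 * (X ^ 2 * (1 - X) ^ 2 * ((c p.1 * c p.2 : ℕ) : ℝ[X]) *
        (∏ w ∈ (Finset.univ.erase p.1).erase p.2, hubDiag n (c w)) *
          X ^ (2 * (p.2 - p.1).val)) =
      X ^ 2 * ((1 - X) ^ 2 * (∏ w, hubDiag n (c w)) * (X ^ (2 * (p.2 - p.1).val) *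
        ((if c p.1 * c p.2 = 2 then 2 * hubDiag n 2 else 0) +
          if c p.1 * c p.2 = 4 then 4 * hubDiag n 1 else 0))) := by
    intro p hp
    have hne := (Finset.mem_offDiag.mp hp).2.2
    have hprod : ∏ w, hubDiag n (c w) = hubDiag n (c p.1) * (hubDiag n (c p.2) *
        ∏ w ∈ (Finset.univ.erase p.1).erase p.2, hubDiag n (c w)) := by
      rw [Finset.mul_prod_erase (Finset.univ.erase p.1) (fun w => hubDiag n (c w))
        (Finset.mem_erase.mpr ⟨hne.symm, Finset.mem_univ _⟩),
        Finset.mul_prod_erase Finset.univ (fun w => hubDiag n (c w)) (Finset.mem_univ _)]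
    rw [hprod]
    have ha := h2 p.1
    have hb := h2 p.2
    have hab : ¬ (c p.1 = 1 ∧ c p.2 = 1) := fun h => hne (h1 _ _ h.1 h.2)
    generalize c p.1 = a at *
    generalize c p.2 = b at *
    interval_cases a <;> interval_cases b <;> simp at hab ⊢ <;> ring
  rw [Finset.mul_sum, Finset.sum_congr rfl hterm, ← Finset.mul_sum, ← Finset.mul_sum]
  congr 2
  rw [← Finset.sum_fiberwise_of_maps_to (s := (Finset.univ : Finset (Fin (n + 3))).offDiag)
    (t := Finset.range (n + 3)) (g := fun p => (p.2 - p.1).val)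
    (fun p _ => Finset.mem_range.mpr (p.2 - p.1).2)]
  refine Finset.sum_congr rfl fun d _ => ?_
  rw [Finset.sum_congr rfl (g := fun p => X ^ (2 * d) *
        ((if c p.1 * c p.2 = 2 then 2 * hubDiag n 2 else 0) +
          if c p.1 * c p.2 = 4 then 4 * hubDiag n 1 else 0))
      (fun p hp => by rw [(Finset.mem_filter.mp hp).2]), ← Finset.mul_sum,
    Finset.sum_add_distrib, ← Finset.sum_filter, ← Finset.sum_filter, Finset.filter_filter,
    Finset.filter_filter, Finset.sum_const, Finset.sum_const]
  simp only [pairCount, nsmul_eq_mul]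
  ring

end HubExpansion

/-! ### Comparing two hub patterns with equal determinants -/

section Comparison

variable {n : ℕ}

theorem eval_zero_hubDiag (n a : ℕ) : (hubDiag n a).eval 0 = 1 := by
  simp [hubDiag]

theorem exists_two_mul_det_hubMatrix {D : ℕ} {c : Fin (n + 3) → ℕ} (hDn : 3 * D ≤ n)
    (hc : IsSeparated D c) (h2 : ∀ u, c u ≤ 2) (h1 : ∀ u v, c u = 1 → c v = 1 → u = v) :
    ∃ y : ℝ[X], hubDiag n 1 * hubDiag n 2 ^ 2 * (2 * (hubMatrix c).det) =
      hubDiag n 1 * hubDiag n 2 ^ 2 * (2 * ∏ w, hubDiag n (c w)) -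
      X ^ 2 * (2 * ((1 - X) ^ 2 * ∏ w, hubDiag n (c w)) * ∑ d ∈ Finset.range (n + 3),
        X ^ (2 * d) * (2 * (pairCount c 2 d : ℝ[X]) * hubDiag n 2 +
          4 * (pairCount c 4 d : ℝ[X]) * hubDiag n 1)) + X ^ (3 * D + 3) * y := by
  obtain ⟨w, hw⟩ := dvd_two_mul_det_sub (hubMatrix c) _ (dvd_prod_hubMatrix hc)
  obtain ⟨y, hy⟩ := sum_offDiag_hubMatrix c
  have hT := sum_offDiag_hubDiag h2 h1
  have hdiag : ∏ i, hubMatrix c i i = ∏ w, hubDiag n (c w) :=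
    Finset.prod_congr rfl fun w _ => by simp [hubMatrix]
  rw [hy, hdiag] at hw
  obtain ⟨e, rfl⟩ : ∃ e, n = 3 * D + e := ⟨n - 3 * D, by omega⟩
  generalize hubDiag (3 * D + e) 1 * hubDiag (3 * D + e) 2 ^ 2 = κ at hT ⊢
  refine ⟨κ * (w - X ^ e * y), ?_⟩
  have hw' := congrArg (fun t => κ * t) (eq_add_of_sub_eq hw)
  simp only [mul_add, mul_sub] at hw'
  rw [hw']
  linear_combination (-2) * hT

/-- The diagonal terms cancel by `hprod`. From the error X^(3D+3) a factor X² is divided out, and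
the remaining common factor K has constant term 2, so it is prime to X. -/
theorem pow_dvd_sum_pairCount_sub {D : ℕ} {c c' : Fin (n + 3) → ℕ} (hDn : 3 * D ≤ n)
    (hc : IsSeparated D c) (h2 : ∀ u, c u ≤ 2) (h1 : ∀ u v, c u = 1 → c v = 1 → u = v)
    (hc' : IsSeparated D c') (h2' : ∀ u, c' u ≤ 2) (h1' : ∀ u v, c' u = 1 → c' v = 1 → u = v)
    (hprod : ∏ w, hubDiag n (c w) = ∏ w, hubDiag n (c' w))
    (hdet : (hubMatrix c).det = (hubMatrix c').det) :
    (X : ℝ[X]) ^ (3 * D + 1) ∣ ∑ d ∈ Finset.range (n + 3),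
      X ^ (2 * d) * (2 * ((pairCount c 2 d : ℝ[X]) - (pairCount c' 2 d : ℝ[X])) * hubDiag n 2 +
        4 * ((pairCount c 4 d : ℝ[X]) - (pairCount c' 4 d : ℝ[X])) * hubDiag n 1) := by
  obtain ⟨y, hy⟩ := exists_two_mul_det_hubMatrix hDn hc h2 h1
  obtain ⟨y', hy'⟩ := exists_two_mul_det_hubMatrix hDn hc' h2' h1'
  rw [hdet, hy', hprod] at hy
  set K : ℝ[X] := 2 * ((1 - X) ^ 2 * ∏ w, hubDiag n (c' w)) with hK
  have hXK : ¬ X ∣ K := by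
    rw [X_dvd_iff, coeff_zero_eq_eval_zero, hK]
    simp [eval_prod, eval_zero_hubDiag]
  refine Polynomial.prime_X.pow_dvd_of_dvd_mul_left _ hXK ?_
  refine ⟨y - y', ?_⟩
  refine mul_left_cancel₀ (pow_ne_zero 2 (X_ne_zero (R := ℝ))) ?_
  have hsum : ∑ d ∈ Finset.range (n + 3),
      X ^ (2 * d) * (2 * ((pairCount c 2 d : ℝ[X]) - (pairCount c' 2 d : ℝ[X])) * hubDiag n 2 +
        4 * ((pairCount c 4 d : ℝ[X]) - (pairCount c' 4 d : ℝ[X])) * hubDiag n 1) =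
      ∑ d ∈ Finset.range (n + 3),
        X ^ (2 * d) * (2 * (pairCount c 2 d : ℝ[X]) * hubDiag n 2 +
          4 * (pairCount c 4 d : ℝ[X]) * hubDiag n 1) -
      ∑ d ∈ Finset.range (n + 3),
        X ^ (2 * d) * (2 * (pairCount c' 2 d : ℝ[X]) * hubDiag n 2 +
          4 * (pairCount c' 4 d : ℝ[X]) * hubDiag n 1) := by
    rw [← Finset.sum_sub_distrib]
    exact Finset.sum_congr rfl fun d _ => by ring
  rw [hsum]
  linear_combination hy

/-- This is the coefficient of X^(2d₀). Smaller distances cancel by hypothesis, larger ones start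
later, and the constant terms of `hubDiag` are 1. -/
theorem pairCount_eq_of_pow_dvd {N d₀ : ℕ} {c c' : Fin (n + 3) → ℕ} (hN : 2 * d₀ < N)
    (hd₀ : d₀ < n + 3)
    (hlt : ∀ d < d₀, pairCount c 2 d = pairCount c' 2 d ∧ pairCount c 4 d = pairCount c' 4 d)
    (hdvd : (X : ℝ[X]) ^ N ∣ ∑ d ∈ Finset.range (n + 3),
      X ^ (2 * d) * (2 * ((pairCount c 2 d : ℝ[X]) - (pairCount c' 2 d : ℝ[X])) * hubDiag n 2 +
        4 * ((pairCount c 4 d : ℝ[X]) - (pairCount c' 4 d : ℝ[X])) * hubDiag n 1)) :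
    pairCount c 2 d₀ + 2 * pairCount c 4 d₀ = pairCount c' 2 d₀ + 2 * pairCount c' 4 d₀ := by
  have h := X_pow_dvd_iff.mp hdvd (2 * d₀) hN
  rw [finsetSum_coeff, Finset.sum_eq_single d₀] at h
  · rw [coeff_X_pow_mul', if_pos le_rfl, Nat.sub_self, coeff_zero_eq_eval_zero] at h
    simp only [eval_add, eval_mul, eval_sub, eval_natCast, eval_zero_hubDiag, eval_ofNat,
      mul_one] at h
    have : (pairCount c 2 d₀ : ℝ) + 2 * pairCount c 4 d₀ =
        pairCount c' 2 d₀ + 2 * pairCount c' 4 d₀ := by linarith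
    exact_mod_cast this
  · intro d _ hne
    rw [coeff_X_pow_mul']
    split_ifs with hle
    · obtain ⟨e1, e2⟩ := hlt d (by omega)
      simp [e1, e2]
    · rfl
  · intro h'
    exact absurd (Finset.mem_range.mpr hd₀) h'

end Comparison

/-! ### Transferring the short-distance statistics -/

section PairCounts

variable {n : ℕ}

theorem fin_val_sub (u v : Fin (n + 3)) :
    (v - u).val = if u.val ≤ v.val then v.val - u.val else n + 3 + v.val - u.val := by
  have hu := u.2
  have hv := v.2
  split_ifs with h
  · exact Fin.coe_sub_iff_le.mpr h
  · exact Fin.coe_sub_iff_lt.mpr (by rw [Fin.lt_def]; omega)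

theorem pairCount_eq_zero_iff {c : Fin (n + 3) → ℕ} {m d : ℕ} :
    pairCount c m d = 0 ↔ ∀ u v, u ≠ v → (v - u).val = d → c u * c v ≠ m := by
  rw [pairCount, Finset.card_eq_zero, Finset.filter_eq_empty_iff]
  constructor
  · intro h u v huv hd hm
    exact h (x := (u, v)) (Finset.mem_offDiag.mpr ⟨Finset.mem_univ u, Finset.mem_univ v, huv⟩)
      ⟨hd, hm⟩
  · rintro h ⟨u, v⟩ huv ⟨hd, hm⟩
    exact h u v (Finset.mem_offDiag.mp huv).2.2 hd hm

theorem pairCount_eq_zero_of_isSeparated {D : ℕ} {c : Fin (n + 3) → ℕ} (hc : IsSeparated D c)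
    {m d : ℕ} (hm : m ≠ 0) (hd : d < D) : pairCount c m d = 0 := by
  rw [pairCount_eq_zero_iff]
  rintro u v huv rfl rfl
  exact absurd (hc u v huv (left_ne_zero_of_mul hm) (right_ne_zero_of_mul hm)) (not_le.mpr hd)

/-- The weights of the vertices of the cycle in a graph whose hubs are `1`-hubs and `2`-hubs, with
at most one `1`-hub. -/
structure IsHubPattern (c : Fin (n + 3) → ℕ) : Prop where
  le_two : ∀ u, c u ≤ 2
  eq_of_one : ∀ u v, c u = 1 → c v = 1 → u = v

theorem IsHubPattern.mul_eq {c : Fin (n + 3) → ℕ} (hp : IsHubPattern c) {u v : Fin (n + 3)}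
    (huv : u ≠ v) (hu : c u ≠ 0) (hv : c v ≠ 0) : c u * c v = 2 ∨ c u * c v = 4 := by
  have h1 := hp.le_two u
  have h2 := hp.le_two v
  have h3 : ¬ (c u = 1 ∧ c v = 1) := fun h => huv (hp.eq_of_one _ _ h.1 h.2)
  generalize c u = a at *
  generalize c v = b at *
  interval_cases a <;> interval_cases b <;> simp_all

theorem IsSeparated.succ {D : ℕ} {c : Fin (n + 3) → ℕ} (hp : IsHubPattern c)
    (hc : IsSeparated D c) (h2 : pairCount c 2 D = 0) (h4 : pairCount c 4 D = 0) :
    IsSeparated (D + 1) c := by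
  intro u v huv hu hv
  refine Nat.lt_of_le_of_ne (hc u v huv hu hv) fun h => ?_
  rcases hp.mul_eq huv hu hv with h' | h'
  · exact pairCount_eq_zero_iff.mp h2 u v huv h.symm h'
  · exact pairCount_eq_zero_iff.mp h4 u v huv h.symm h'

theorem isSeparated_one (c : Fin (n + 3) → ℕ) : IsSeparated 1 c := by
  intro u v huv _ _
  rw [Nat.one_le_iff_ne_zero]
  intro h
  exact huv (sub_eq_zero.mp (Fin.ext h : v - u = 0)).symm

/-- Such a pair contains the unique 1-hub as its first or its second entry, and d then fixes the
other entry. -/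
theorem pairCount_two_le {c : Fin (n + 3) → ℕ} (hp : IsHubPattern c) {d : ℕ} :
    pairCount c 2 d ≤ 2 := by
  have key : ∀ p : Fin (n + 3) × Fin (n + 3), c p.1 * c p.2 = 2 → c p.1 = 1 ∨ c p.2 = 1 := by
    intro p h
    have h1 := hp.le_two p.1
    have h2 := hp.le_two p.2
    generalize c p.1 = a at *
    generalize c p.2 = b at *
    interval_cases a <;> interval_cases b <;> simp_all
  rw [pairCount]
  by_contra hlt
  push Not at hlt
  obtain ⟨x, y, z, hx, hy, hz, hxy, hxz, hyz⟩ := Finset.two_lt_card_iff.mp hlt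
  have hinj1 : ∀ p q : Fin (n + 3) × Fin (n + 3), (p.2 - p.1).val = d → (q.2 - q.1).val = d →
      c p.1 = 1 → c q.1 = 1 → p = q := by
    intro p q h1 h2 h3 h4
    have e1 := hp.eq_of_one _ _ h3 h4
    have e2 : p.2 - p.1 = q.2 - q.1 := Fin.ext (h1.trans h2.symm)
    rw [e1] at e2
    exact Prod.ext e1 (sub_left_injective e2)
  have hinj2 : ∀ p q : Fin (n + 3) × Fin (n + 3), (p.2 - p.1).val = d → (q.2 - q.1).val = d →
      c p.2 = 1 → c q.2 = 1 → p = q := by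
    intro p q h1 h2 h3 h4
    have e1 := hp.eq_of_one _ _ h3 h4
    have e2 : p.2 - p.1 = q.2 - q.1 := Fin.ext (h1.trans h2.symm)
    rw [e1] at e2
    exact Prod.ext (sub_right_injective e2) e1
  obtain ⟨-, hx1, hx2⟩ := Finset.mem_filter.mp hx
  obtain ⟨-, hy1, hy2⟩ := Finset.mem_filter.mp hy
  obtain ⟨-, hz1, hz2⟩ := Finset.mem_filter.mp hz
  rcases key x hx2 with a | a <;> rcases key y hy2 with b | b <;> rcases key z hz2 with e | e
  · exact hxy (hinj1 _ _ hx1 hy1 a b)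
  · exact hxy (hinj1 _ _ hx1 hy1 a b)
  · exact hxz (hinj1 _ _ hx1 hz1 a e)
  · exact hyz (hinj2 _ _ hy1 hz1 b e)
  · exact hyz (hinj1 _ _ hy1 hz1 b e)
  · exact hxz (hinj2 _ _ hx1 hz1 a e)
  · exact hxy (hinj2 _ _ hx1 hy1 a b)
  · exact hxy (hinj2 _ _ hx1 hy1 a b)

/-- The ordered pairs of hubs at clockwise distance `4` or `6`. -/
def linkSet (c : Fin (n + 3) → ℕ) : Finset (Fin (n + 3) × Fin (n + 3)) :=
  (Finset.univ : Finset (Fin (n + 3))).offDiag.filter fun p =>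
    ((p.2 - p.1).val = 4 ∨ (p.2 - p.1).val = 6) ∧ (c p.1 * c p.2 = 2 ∨ c p.1 * c p.2 = 4)

theorem card_linkSet (c : Fin (n + 3) → ℕ) : (linkSet c).card =
    pairCount c 2 4 + pairCount c 4 4 + pairCount c 2 6 + pairCount c 4 6 := by
  simp only [linkSet, pairCount, Finset.card_filter, ← Finset.sum_add_distrib]
  refine Finset.sum_congr rfl fun p _ => ?_
  split_ifs <;> omega

/-- The local statistics of the hubs of a nice graph that are used to recognize niceness. -/
structure HasNiceCounts (c : Fin (n + 3) → ℕ) (k : ℕ) : Prop where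
  separated : IsSeparated 4 c
  two_four : pairCount c 2 4 = 1
  two_five : pairCount c 2 5 = 0
  four_five : pairCount c 4 5 = 0
  le_card : k ≤ pairCount c 2 4 + pairCount c 4 4 + pairCount c 2 6 + pairCount c 4 6

/-- A bootstrap on the separation D of c': precision 3D + 1 exceeds 2D, so the counts at distance D
are visible, and they vanish for D < 4 because they do for c. At D = 4 the precision 13 reaches
distance 6; the bound 12 ≤ n is what 3D ≤ n requires there. -/
theorem HasNiceCounts.transfer {k : ℕ} {c c' : Fin (n + 3) → ℕ} (hn : 12 ≤ n)
    (hp : IsHubPattern c) (hp' : IsHubPattern c')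
    (hprod : ∏ w, hubDiag n (c w) = ∏ w, hubDiag n (c' w))
    (hdet : (hubMatrix c).det = (hubMatrix c').det)
    (hc : HasNiceCounts c k) (h6 : pairCount c 2 6 = 0) :
    IsSeparated 4 c' ∧ pairCount c' 2 4 = 1 ∧ pairCount c' 2 5 = 0 ∧ pairCount c' 4 5 = 0 ∧
      pairCount c' 4 4 = pairCount c 4 4 ∧
      pairCount c' 2 6 + 2 * pairCount c' 4 6 = 2 * pairCount c 4 6 := by
  have hdvd : ∀ D, D ≤ 4 → IsSeparated D c' → _ := fun D hD hs =>
    pow_dvd_sum_pairCount_sub (D := D) (by omega)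
      (fun u v h1 h2 h3 => hD.trans (hc.separated u v h1 h2 h3)) hp.le_two hp.eq_of_one
      hs hp'.le_two hp'.eq_of_one hprod hdet
  have hzero : ∀ D, D ≤ 4 → IsSeparated D c' → ∀ d < D,
      pairCount c 2 d = pairCount c' 2 d ∧ pairCount c 4 d = pairCount c' 4 d := by
    intro D hD hs d hd
    rw [pairCount_eq_zero_of_isSeparated hc.separated (by norm_num) (by omega),
      pairCount_eq_zero_of_isSeparated hc.separated (by norm_num) (by omega),
      pairCount_eq_zero_of_isSeparated hs (by norm_num) hd,
      pairCount_eq_zero_of_isSeparated hs (by norm_num) hd]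
    exact ⟨rfl, rfl⟩
  have hstep : ∀ D, 1 ≤ D → D ≤ 3 → IsSeparated D c' → IsSeparated (D + 1) c' := by
    intro D h1 hD hs
    have h := pairCount_eq_of_pow_dvd (d₀ := D) (by omega) (by omega) (hzero D (by omega) hs)
      (hdvd D (by omega) hs)
    rw [pairCount_eq_zero_of_isSeparated hc.separated (by norm_num) (by omega),
      pairCount_eq_zero_of_isSeparated hc.separated (by norm_num) (by omega)] at h
    exact hs.succ hp' (by omega) (by omega)
  have hs4 : IsSeparated 4 c' :=
    hstep 3 (by norm_num) le_rfl (hstep 2 (by norm_num) (by norm_num)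
      (hstep 1 le_rfl (by norm_num) (isSeparated_one c')))
  have hd4 := hdvd 4 le_rfl hs4
  have hz4 := hzero 4 le_rfl hs4
  have e4 := pairCount_eq_of_pow_dvd (d₀ := 4) (by omega) (by omega) hz4 hd4
  rw [hc.two_four] at e4
  have hle := pairCount_two_le hp' (d := 4)
  -- The count is odd by `e4` and at most 2.
  have ha : pairCount c' 2 4 = 1 := by omega
  have hb : pairCount c' 4 4 = pairCount c 4 4 := by omega
  have hz5 : ∀ d < 5, pairCount c 2 d = pairCount c' 2 d ∧ pairCount c 4 d = pairCount c' 4 d := by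
    intro d hd
    rcases Nat.lt_succ_iff_lt_or_eq.mp hd with h | rfl
    · exact hz4 d h
    · exact ⟨by rw [ha, hc.two_four], hb.symm⟩
  have e5 := pairCount_eq_of_pow_dvd (d₀ := 5) (by omega) (by omega) hz5 hd4
  rw [hc.two_five, hc.four_five] at e5
  have hz6 : ∀ d < 6, pairCount c 2 d = pairCount c' 2 d ∧ pairCount c 4 d = pairCount c' 4 d := by
    intro d hd
    rcases Nat.lt_succ_iff_lt_or_eq.mp hd with h | rfl
    · exact hz5 d h
    · rw [hc.two_five, hc.four_five]; omega
  have e6 := pairCount_eq_of_pow_dvd (d₀ := 6) (by omega) (by omega) hz6 hd4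
  exact ⟨hs4, ha, by omega, by omega, hb, by omega⟩

end PairCounts

/-! ### Pair counts under rotation and reflection -/

section Orientation

variable {n : ℕ} {c : Fin (n + 3) → ℕ}

theorem pairCount_comp_add (r : Fin (n + 3)) (m d : ℕ) :
    pairCount (fun i => c (r + i)) m d = pairCount c m d := by
  refine Finset.card_nbij' (fun p => (r + p.1, r + p.2)) (fun p => (p.1 - r, p.2 - r)) ?_ ?_ ?_ ?_
  · rintro ⟨u, v⟩ h
    simpa using h
  · rintro ⟨u, v⟩ h
    simpa using h
  · rintro ⟨u, v⟩ _
    simp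
  · rintro ⟨u, v⟩ _
    simp

theorem pairCount_comp_sub (r : Fin (n + 3)) (m d : ℕ) :
    pairCount (fun i => c (r - i)) m d = pairCount c m d := by
  refine Finset.card_nbij' (fun p => (r - p.2, r - p.1)) (fun p => (r - p.2, r - p.1)) ?_ ?_ ?_ ?_
  · rintro ⟨u, v⟩ h
    simp at h ⊢
    exact ⟨fun e => h.1 e.symm, h.2.1, by rw [mul_comm]; exact h.2.2⟩
  · rintro ⟨u, v⟩ h
    simp at h ⊢
    exact ⟨fun e => h.1 e.symm, h.2.1, by rw [mul_comm]; exact h.2.2⟩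
  · rintro ⟨u, v⟩ _
    simp
  · rintro ⟨u, v⟩ _
    simp

end Orientation

/-! ### Reconstructing the hub positions from the counts -/

section Positions

variable {n : ℕ} {c : Fin (n + 3) → ℕ}

/-- Links of length 4 or 6 have distinct endpoints, none of them 0. There are at least k links and
exactly k other hubs, so every other hub has a predecessor at distance 4 or 6. Sorting the hubs
gives the positions. -/
theorem exists_positions {k : ℕ} (hk : 1 ≤ k) (hp : IsHubPattern c)
    (hc : HasNiceCounts c k)
    (hcard : (Finset.univ.filter fun i => c i ≠ 0).card = k + 1) (h0 : c 0 = 1)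
    (h4 : ∃ v : Fin (n + 3), v.val = 4 ∧ c v ≠ 0) (h6 : Even (pairCount c 2 6)) :
    ∃ p : ℕ → Fin (n + 3), (p 0 : ℕ) = 0 ∧ (p 1 : ℕ) = 4 ∧
      (∀ j, 1 ≤ j → j < k → (p (j + 1) : ℕ) = p j + 4 ∨ (p (j + 1) : ℕ) = p j + 6) ∧
      ∀ j, 1 ≤ j → j ≤ k → c (p j) = 2 := by
  obtain ⟨w, hw4, hcw⟩ := h4
  have hsep := hc.separated
  have hw0 : (0 : Fin (n + 3)) ≠ w := by
    intro h; rw [← h] at hw4; simp at hw4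
  have hcw2 : c w = 2 := by
    have h1 := hp.le_two w
    have h2 : c w ≠ 1 := fun h => hw0 (hp.eq_of_one _ _ h0 h)
    omega
  have hprod : ∀ u, u ≠ 0 → c u ≠ 0 → c u * c 0 = 2 := by
    intro u hu hcu
    have h1 := hp.le_two u
    have h2 : c u ≠ 1 := fun h => hu (hp.eq_of_one _ _ h h0)
    have : c u = 2 := by omega
    rw [this, h0]
  -- A hub 6 steps clockwise after 0 would be only 2 after w. So a counted pair must end at 0, there
  -- is at most one, and evenness leaves none.
  have h60 : pairCount c 2 6 = 0 := by
    have hle : pairCount c 2 6 ≤ 1 := by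
      rw [pairCount, Finset.card_le_one]
      have key : ∀ p ∈ (Finset.univ : Finset (Fin (n + 3))).offDiag.filter
          (fun p => (p.2 - p.1).val = 6 ∧ c p.1 * c p.2 = 2), p.2 = 0 := by
        rintro ⟨u, v⟩ hmem
        obtain ⟨hne, hd, hm⟩ := Finset.mem_filter.mp hmem
        have hu2 := hp.le_two u
        have hv2 := hp.le_two v
        simp only at hd hm ⊢
        by_contra hv0
        have hcv : c v ≠ 1 := fun h => hv0 (hp.eq_of_one _ _ h h0)
        have hcu : c u = 1 := by
          generalize c u = a at *
          generalize c v = b at *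
          interval_cases a <;> interval_cases b <;> simp_all
        obtain rfl := hp.eq_of_one _ _ hcu h0
        rw [sub_zero] at hd
        have hwv : w ≠ v := by
          intro h; rw [h] at hw4; omega
        have hvne : c v ≠ 0 := by intro h; rw [h] at hm; omega
        have := hsep w v hwv hcw hvne
        rw [fin_val_sub] at this
        split_ifs at this <;> omega
      intro p hp' q hq'
      have e1 := key p hp'
      have e2 := key q hq'
      have d1 := (Finset.mem_filter.mp hp').2.1
      have d2 := (Finset.mem_filter.mp hq').2.1
      have e3 : p.2 - p.1 = q.2 - q.1 := Fin.ext (d1.trans d2.symm)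
      rw [e1, e2] at e3
      exact Prod.ext (sub_right_injective e3) (e1.trans e2.symm)
    obtain ⟨t, ht⟩ := h6
    omega
  set hubs := Finset.univ.filter fun i => c i ≠ 0 with hhubs
  have h0mem : (0 : Fin (n + 3)) ∈ hubs := by simp [hhubs, h0]
  -- every hub other than `0` is the endpoint of a link
  have hmaps : ∀ p ∈ linkSet c, p.2 ∈ hubs.erase 0 := by
    rintro ⟨u, v⟩ hmem
    obtain ⟨hne, hd, hm⟩ := Finset.mem_filter.mp hmem
    have hne' := (Finset.mem_offDiag.mp hne).2.2
    simp only at hd hm hne' ⊢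
    have hcv : c v ≠ 0 := by rintro h; rw [h] at hm; omega
    have hcu : c u ≠ 0 := by rintro h; rw [h] at hm; omega
    refine Finset.mem_erase.mpr ⟨?_, by simp [hhubs, hcv]⟩
    rintro rfl
    have hm2 := hprod u hne' hcu
    rcases hd with hd | hd
    -- A link of length 4 into 0 would be a second pair of weight 2 at distance 4, besides (0, w).
    · have h1 : ({(u, 0), (0, w)} : Finset (Fin (n + 3) × Fin (n + 3))) ⊆
          (Finset.univ : Finset (Fin (n + 3))).offDiag.filter
            (fun p => (p.2 - p.1).val = 4 ∧ c p.1 * c p.2 = 2) := by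
        intro p hp'
        rcases Finset.mem_insert.mp hp' with rfl | hp'
        · rw [zero_sub] at hd
          simp [hne', hd, hm2]
        · rw [Finset.mem_singleton] at hp'
          subst hp'
          simp [hw0, hw4, h0, hcw2]
      have h2 := Finset.card_le_card h1
      rw [Finset.card_pair (by simp [hne'])] at h2
      have := hc.two_four
      rw [pairCount] at this
      omega
    · exact pairCount_eq_zero_iff.mp h60 u 0 hne' hd hm2
  -- Two links with the same end start at distance 2 from one another, against the separation.
  have hinj : Set.InjOn Prod.snd (linkSet c : Set (Fin (n + 3) × Fin (n + 3))) := by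
    rintro ⟨u, v⟩ hu ⟨u', v'⟩ hu' (rfl : v = v')
    obtain ⟨hne, hd, hm⟩ := Finset.mem_filter.mp hu
    obtain ⟨hne', hd', hm'⟩ := Finset.mem_filter.mp hu'
    simp only at hd hm hd' hm'
    by_contra hcon
    have huu : u ≠ u' := fun h => hcon (by rw [h])
    have hcu : c u ≠ 0 := by rintro h; rw [h] at hm; omega
    have hcu' : c u' ≠ 0 := by rintro h; rw [h] at hm'; omega
    have s1 := hsep u u' huu hcu hcu'
    have s2 := hsep u' u huu.symm hcu' hcu
    have hv1 : u.val ≠ u'.val := fun h => huu (Fin.ext h)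
    rw [fin_val_sub] at s1 s2 hd hd'
    have := u.2
    have := u'.2
    have := v.2
    split_ifs at s1 s2 hd hd' <;> omega
  have hpred : ∀ v ∈ hubs, v ≠ 0 → ∃ u ∈ hubs, u < v ∧ v.val - u.val ≤ 6 := by
    intro v hv hv0
    have hsurj := Finset.surj_on_of_inj_on_of_card_le (s := linkSet c) (t := hubs.erase 0)
      (fun p _ => p.2) hmaps (fun p q hp' hq' h => hinj hp' hq' h)
      (by rw [Finset.card_erase_of_mem h0mem, hcard, card_linkSet]; exact hc.le_card)
    obtain ⟨⟨u, v'⟩, hmem, hvv⟩ := hsurj v (Finset.mem_erase.mpr ⟨hv0, hv⟩)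
    simp only at hvv
    subst hvv
    obtain ⟨hne, hd, hm⟩ := Finset.mem_filter.mp hmem
    simp only at hd hm
    have hcv : c v ≠ 0 := by rintro h; rw [h] at hm; omega
    have hcu : c u ≠ 0 := by rintro h; rw [h] at hm; omega
    refine ⟨u, by simp [hhubs, hcu], ?_⟩
    have s1 := hsep 0 v hv0.symm (by omega) hcv
    rw [sub_zero] at s1
    rw [fin_val_sub] at hd
    have hu := u.2
    have hvv := v.2
    rw [Fin.lt_def]
    split_ifs at hd with hle
    · have : u.val ≠ v.val := by omega
      omega
    -- A link wrapping past the hub 0 would have length at least 4 + 4.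
    · have hu0 : u ≠ 0 := by
        rintro rfl; simp at hle
      have s2 := hsep u 0 hu0 hcu (by omega)
      rw [fin_val_sub, Fin.val_zero] at s2
      split_ifs at s2 <;> omega
  let e := hubs.orderEmbOfFin hcard
  have hemem : ∀ i, e i ∈ hubs := fun i => Finset.orderEmbOfFin_mem _ _ _
  have hesurj : ∀ v ∈ hubs, ∃ i, e i = v := by
    intro v hv
    have : v ∈ Set.range e := by rw [Finset.range_orderEmbOfFin]; exact hv
    exact this
  have he0 : e 0 = 0 := by
    obtain ⟨i, hi⟩ := hesurj 0 h0mem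
    have : e 0 ≤ e i := e.monotone (Fin.zero_le i)
    rw [hi] at this
    exact le_antisymm this (Fin.zero_le _)
  -- The link into a hub starts at or before the previous hub, so the gap is at most 6; it is at
  -- least 4 by separation and is not 5.
  have hstep : ∀ j (hj : j < k), (e ⟨j + 1, by omega⟩).val = (e ⟨j, by omega⟩).val + 4 ∨
      (e ⟨j + 1, by omega⟩).val = (e ⟨j, by omega⟩).val + 6 := by
    intro j hj
    set a := e ⟨j, by omega⟩ with ha
    set b := e ⟨j + 1, by omega⟩ with hb
    have hab : a < b := e.strictMono (Fin.mk_lt_mk.mpr (Nat.lt_succ_self j))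
    have hb0 : b ≠ 0 := (lt_of_le_of_lt (Fin.zero_le a) hab).ne'
    obtain ⟨u, hu, hub, hd⟩ := hpred b (hemem _) hb0
    obtain ⟨i, rfl⟩ := hesurj u hu
    have hij : i.val < j + 1 := Fin.lt_def.mp (e.lt_iff_lt.mp hub)
    have hua : e i ≤ a := e.monotone (Fin.le_def.mpr (Nat.lt_succ_iff.mp hij))
    have hca : c a ≠ 0 := (Finset.mem_filter.mp (hemem _)).2
    have hcb : c b ≠ 0 := (Finset.mem_filter.mp (hemem _)).2
    have s1 := hsep a b hab.ne hca hcb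
    have hne5 : (b - a).val ≠ 5 := by
      intro h5
      rcases hp.mul_eq hab.ne hca hcb with h' | h'
      · exact pairCount_eq_zero_iff.mp hc.two_five a b hab.ne h5 h'
      · exact pairCount_eq_zero_iff.mp hc.four_five a b hab.ne h5 h'
    rw [Fin.lt_def] at hab hub
    rw [Fin.le_def] at hua
    rw [fin_val_sub, if_pos hab.le] at s1 hne5
    omega
  refine ⟨fun j => if h : j < k + 1 then e ⟨j, h⟩ else 0, ?_, ?_, ?_, ?_⟩
  · simp only [Nat.succ_pos, dif_pos]
    exact congrArg Fin.val he0
  · have h1k : 1 < k + 1 := by omega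
    simp only [h1k, dif_pos]
    -- The first gap is 4 rather than 6, because the hub w at 4 is not before the second hub in
    -- order.
    have h1 := hstep 0 (by omega)
    have he0' : (e ⟨0, by omega⟩).val = 0 := congrArg Fin.val he0
    rw [he0'] at h1
    obtain ⟨i, hi⟩ := hesurj w (by simp [hhubs, hcw])
    have hi0 : i.val ≠ 0 := by
      intro h
      have : i = 0 := Fin.ext h
      rw [this, he0] at hi
      exact hw0 hi
    have h2 : e ⟨1, by omega⟩ ≤ e i := e.monotone (Fin.le_def.mpr (by simp; omega))
    rw [hi, Fin.le_def, hw4] at h2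
    simp only [zero_add] at h1
    omega
  · intro j _ hj
    have h1 : j < k + 1 := by omega
    have h2 : j + 1 < k + 1 := by omega
    simp only [h1, h2, dif_pos]
    exact hstep j hj
  · intro j hj hjk
    have h1 : j < k + 1 := by omega
    simp only [h1, dif_pos]
    have hne : c (e ⟨j, h1⟩) ≠ 0 := (Finset.mem_filter.mp (hemem _)).2
    have h2 := hp.le_two (e ⟨j, h1⟩)
    have h3 : c (e ⟨j, h1⟩) ≠ 1 := by
      intro h
      have := hp.eq_of_one _ _ h h0
      rw [← he0] at this
      have := congrArg Fin.val (e.injective this)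
      simp at this
      omega
    omega

end Positions

/-! ### Short-distance statistics of a nice graph -/

section NicePositions

variable {n k : ℕ} {c : Fin (n + 3) → ℕ} {p : ℕ → Fin (n + 3)}

theorem le_position_sub (h1 : (p 0 : ℕ) = 0) (h4 : (p 1 : ℕ) = 4)
    (hstep : ∀ j, 1 ≤ j → j < k → (p (j + 1) : ℕ) = p j + 4 ∨ (p (j + 1) : ℕ) = p j + 6)
    {j d : ℕ} (hjd : j + d ≤ k) : (p j : ℕ) + 4 * d ≤ p (j + d) := by
  induction d with
  | zero => simp
  | succ d ih =>
    have ih' := ih (by omega)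
    rw [← add_assoc]
    rcases Nat.eq_zero_or_pos (j + d) with h0 | h0
    · have hj : j = 0 := by omega
      have hd : d = 0 := by omega
      subst hj hd
      simp only [zero_add, h1, h4]
      omega
    · rcases hstep (j + d) h0 (by omega) with h | h <;> omega

theorem position_le (h4 : (p 1 : ℕ) = 4)
    (hstep : ∀ j, 1 ≤ j → j < k → (p (j + 1) : ℕ) = p j + 4 ∨ (p (j + 1) : ℕ) = p j + 6)
    {j : ℕ} (hj : j + 1 ≤ k) : (p (j + 1) : ℕ) ≤ 6 * j + 4 := by
  induction j with
  | zero => simp [h4]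
  | succ j ih =>
    have ih' := ih (by omega)
    rcases hstep (j + 1) (by omega) (by omega) with h | h <;> omega

/-- Two successive gaps already total at least 8. Going backwards means wrapping around: the last
hub is at 6k - 2 or earlier, so the wrap is at least 12k - (6k - 2) ≥ 8. -/
theorem eq_succ_of_position_sub_le (hmax : max (12 * k) 15 ≤ n + 3)
    (h0 : (p 0 : ℕ) = 0) (h4 : (p 1 : ℕ) = 4)
    (hstep : ∀ j, 1 ≤ j → j < k → (p (j + 1) : ℕ) = p j + 4 ∨ (p (j + 1) : ℕ) = p j + 6)
    {i j : ℕ} (hi : i ≤ k) (hj : j ≤ k) (hne : p i ≠ p j) (hle : (p j - p i).val ≤ 7) :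
    j = i + 1 ∧ ((p j - p i).val = 4 ∨ (i ≠ 0 ∧ (p j - p i).val = 6)) := by
  rw [fin_val_sub] at *
  have hij : i ≠ j := fun h => hne (by rw [h])
  rcases lt_or_gt_of_ne hij with hlt | hlt
  · obtain ⟨d, rfl⟩ : ∃ d, j = i + 1 + d := ⟨j - i - 1, by omega⟩
    have g1 := le_position_sub h0 h4 hstep (j := i) (d := 1 + d) (by omega)
    rw [← add_assoc] at g1
    have g2 : (p i : ℕ) ≤ p (i + 1 + d) := by omega
    rw [if_pos g2] at hle ⊢
    have hd : d = 0 := by omega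
    subst hd
    refine ⟨rfl, ?_⟩
    rcases Nat.eq_zero_or_pos i with rfl | hi0
    · simp only [zero_add, add_zero] at *
      omega
    · have := hstep i hi0 (by omega)
      rw [add_zero] at *
      omega
  · exfalso
    have g1 := le_position_sub h0 h4 hstep (j := j) (d := i - j) (by omega)
    rw [show j + (i - j) = i by omega] at g1
    have g2 : ¬ (p i : ℕ) ≤ p j := by omega
    rw [if_neg g2] at hle
    obtain ⟨t, rfl⟩ : ∃ t, i = t + 1 := ⟨i - 1, by omega⟩
    have g3 := position_le h4 hstep hi
    have := le_max_left (12 * k) 15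
    have := le_max_right (12 * k) 15
    omega

theorem isHubPattern_of_positions (hc0 : c (p 0) = 1) (hc2 : ∀ j, 1 ≤ j → j ≤ k → c (p j) = 2)
    (hhub : ∀ u, c u ≠ 0 → ∃ j ≤ k, p j = u) : IsHubPattern c := by
  have key : ∀ u, c u = 0 ∨ (c u = 1 ∧ u = p 0) ∨ c u = 2 := by
    intro u
    by_cases hu : c u = 0
    · exact Or.inl hu
    · obtain ⟨j, hj, rfl⟩ := hhub u hu
      rcases Nat.eq_zero_or_pos j with rfl | h
      · exact Or.inr (Or.inl ⟨hc0, rfl⟩)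
      · exact Or.inr (Or.inr (hc2 j h hj))
  constructor
  · intro u
    rcases key u with h | h | h <;> omega
  · intro u v hu hv
    rcases key u with h | h | h
    · omega
    · rcases key v with h' | h' | h'
      · omega
      · exact h.2.trans h'.2.symm
      · omega
    · omega

theorem hasNiceCounts_of_positions (hk : 1 ≤ k) (hmax : max (12 * k) 15 ≤ n + 3)
    (h0 : (p 0 : ℕ) = 0) (h4 : (p 1 : ℕ) = 4)
    (hstep : ∀ j, 1 ≤ j → j < k → (p (j + 1) : ℕ) = p j + 4 ∨ (p (j + 1) : ℕ) = p j + 6)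
    (hc0 : c (p 0) = 1) (hc2 : ∀ j, 1 ≤ j → j ≤ k → c (p j) = 2)
    (hhub : ∀ u, c u ≠ 0 → ∃ j ≤ k, p j = u) :
    HasNiceCounts c k ∧ pairCount c 2 6 = 0 := by
  have hp := isHubPattern_of_positions hc0 hc2 hhub
  have key : ∀ u v, u ≠ v → c u ≠ 0 → c v ≠ 0 → (v - u).val ≤ 7 →
      ∃ i < k, u = p i ∧ v = p (i + 1) ∧
        ((v - u).val = 4 ∨ (i ≠ 0 ∧ (v - u).val = 6)) := by
    intro u v huv hu hv hle
    obtain ⟨i, hi, rfl⟩ := hhub u hu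
    obtain ⟨j, hj, rfl⟩ := hhub v hv
    obtain ⟨rfl, h⟩ := eq_succ_of_position_sub_le hmax h0 h4 hstep hi hj huv hle
    exact ⟨i, by omega, rfl, rfl, h⟩
  have hsub : ∀ j < k, p j ≠ p (j + 1) ∧
      ((p (j + 1) - p j).val = 4 ∨ (p (j + 1) - p j).val = 6) := by
    intro j hj
    have h : (p (j + 1) : ℕ) = p j + 4 ∨ (p (j + 1) : ℕ) = p j + 6 := by
      rcases Nat.eq_zero_or_pos j with rfl | hj0
      · left; simp [h0, h4]
      · exact hstep j hj0 hj
    refine ⟨fun h' => by rw [← h'] at h; omega, ?_⟩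
    rw [fin_val_sub]
    split_ifs <;> omega
  have h5 : ∀ m, m ≠ 0 → pairCount c m 5 = 0 := by
    intro m hm
    rw [pairCount_eq_zero_iff]
    rintro u v huv hd rfl
    obtain ⟨i, -, -, -, h⟩ := key u v huv (left_ne_zero_of_mul hm) (right_ne_zero_of_mul hm)
      (by omega)
    omega
  have h6 : pairCount c 2 6 = 0 := by
    rw [pairCount_eq_zero_iff]
    rintro u v huv hd hm
    have hm0 : c u * c v ≠ 0 := by omega
    obtain ⟨i, hi, rfl, rfl, h⟩ := key u v huv (left_ne_zero_of_mul hm0) (right_ne_zero_of_mul hm0)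
      (by omega)
    -- The gap after the 1-hub is 4, so a gap of 6 joins two 2-hubs, whose product is 4.
    have hi0 : i ≠ 0 := by omega
    rw [hc2 i (by omega) (by omega), hc2 (i + 1) (by omega) (by omega)] at hm
    omega
  have h24 : pairCount c 2 4 = 1 := by
    rw [pairCount, Finset.card_eq_one]
    refine ⟨(p 0, p 1), ?_⟩
    ext ⟨u, v⟩
    simp only [Finset.mem_filter, Finset.mem_offDiag, Finset.mem_univ, true_and,
      Finset.mem_singleton, Prod.mk.injEq]
    constructor
    · rintro ⟨huv, hd, hm⟩
      have hm0 : c u * c v ≠ 0 := by omega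
      obtain ⟨i, hi, rfl, rfl, h⟩ := key u v huv (left_ne_zero_of_mul hm0)
        (right_ne_zero_of_mul hm0) (by omega)
      by_cases hi0 : i = 0
      · subst hi0
        exact ⟨rfl, rfl⟩
      · rw [hc2 i (by omega) (by omega), hc2 (i + 1) (by omega) (by omega)] at hm
        omega
    · rintro ⟨rfl, rfl⟩
      refine ⟨(hsub 0 (by omega)).1, ?_, by rw [hc0, hc2 1 le_rfl hk]⟩
      rw [fin_val_sub, h0, h4]
      rfl
  refine ⟨⟨?_, h24, h5 2 (by norm_num), h5 4 (by norm_num), ?_⟩, h6⟩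
  · intro u v huv hu hv
    by_contra hlt
    obtain ⟨i, -, -, -, h⟩ := key u v huv hu hv (by omega)
    omega
  · rw [← card_linkSet]
    have hmem : ∀ j ≤ k, c (p j) ≠ 0 := by
      intro j hj
      rcases Nat.eq_zero_or_pos j with rfl | h
      · rw [hc0]; norm_num
      · rw [hc2 j h hj]; norm_num
    have hcard := Finset.card_le_card_of_injOn (s := Finset.range k) (t := linkSet c)
      (fun j => (p j, p (j + 1))) ?_ ?_
    · rwa [Finset.card_range] at hcard
    · intro j hj
      have hj' : j < k := by simpa using hj
      obtain ⟨hne, hd⟩ := hsub j hj'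
      simp only [linkSet, Finset.coe_filter, Finset.mem_offDiag, Finset.mem_univ, true_and,
        Set.mem_ofPred_eq]
      exact ⟨hne, hd, hp.mul_eq hne (hmem j (by omega)) (hmem (j + 1) (by omega))⟩
    · intro i hi j hj hij
      have hi' : i < k := by simpa using hi
      have hj' : j < k := by simpa using hj
      have heq : p i = p j := congrArg Prod.fst hij
      by_contra hne
      rcases lt_or_gt_of_ne hne with h | h
      · have g := le_position_sub h0 h4 hstep (j := i) (d := j - i) (by omega)
        rw [show i + (j - i) = j by omega, heq] at g
        omega
      · have g := le_position_sub h0 h4 hstep (j := j) (d := i - j) (by omega)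
        rw [show j + (i - j) = i by omega, heq] at g
        omega

end NicePositions

/-! ### Cycles and triangles as two-dense sets -/

section CycleSubgraphs

open SimpleGraph

variable {V : Type*} {G : SimpleGraph V} {n : ℕ}

theorem cycleGraph_adj_val {u v : Fin (n + 3)} :
    (cycleGraph (n + 3)).Adj u v ↔ (u - v).val = 1 ∨ (v - u).val = 1 :=
  cycleGraph_adj'

theorem exists_adj_cycleGraph (i : Fin (n + 3)) :
    ∃ a b, a ≠ b ∧ (cycleGraph (n + 3)).Adj i a ∧ (cycleGraph (n + 3)).Adj i b := by
  refine ⟨i + 1, i - 1, ?_, ?_, ?_⟩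
  · intro h
    have := congrArg Fin.val h
    rw [fin_val_add_one, fin_val_sub_one] at this
    split_ifs at this <;> omega
  · rw [cycleGraph_adj_val]
    right
    simp
  · rw [cycleGraph_adj_val]
    left
    simp

theorem isTwoDense_range (f : cycleGraph (n + 3) ↪g G) : IsTwoDense G (Set.range f) := by
  rintro _ ⟨i, rfl⟩
  obtain ⟨a, b, hab, ha, hb⟩ := exists_adj_cycleGraph i
  exact ⟨f a, ⟨a, rfl⟩, f b, ⟨b, rfl⟩, fun h => hab (f.injective h), f.map_rel_iff.mpr ha,
    f.map_rel_iff.mpr hb⟩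

/-- A triangle is two-dense, so it would lie inside the induced cycle, which has length at least 4.
-/
theorem false_of_triangle {m : ℕ} (hm : 4 ≤ m) (f : cycleGraph m ↪g G)
    (hf : ∀ T : Set V, IsTwoDense G T → T ⊆ Set.range f) {u v w : V} (huv : G.Adj u v)
    (hvw : G.Adj v w) (hwu : G.Adj w u) : False := by
  obtain ⟨n, rfl⟩ : ∃ n, m = n + 3 := ⟨m - 3, by omega⟩
  have hT : IsTwoDense G {u, v, w} := by
    rintro x (rfl | rfl | rfl)
    · exact ⟨v, by simp, w, by simp, hvw.ne, huv, hwu.symm⟩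
    · exact ⟨u, by simp, w, by simp, hwu.ne.symm, huv.symm, hvw⟩
    · exact ⟨u, by simp, v, by simp, huv.ne, hwu, hvw.symm⟩
  obtain ⟨a, rfl⟩ := hf _ hT (show u ∈ ({u, v, w} : Set V) by simp)
  obtain ⟨b, rfl⟩ := hf _ hT (show v ∈ ({_, v, w} : Set V) by simp)
  obtain ⟨c, rfl⟩ := hf _ hT (show w ∈ ({_, _, w} : Set V) by simp)
  rw [f.map_rel_iff, cycleGraph_adj_val, fin_val_sub, fin_val_sub] at huv hvw hwu
  have := a.2
  have := b.2
  have := c.2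
  split_ifs at huv hvw hwu <;> omega

end CycleSubgraphs

/-! ### Degree sums of a sun-like graph -/

section SunLikeDegrees

open SimpleGraph

variable {V : Type*} [Fintype V] {G : SimpleGraph V} [DecidableRel G.Adj] {n : ℕ}

theorem two_le_degree_of_adj {v a b : V} (hab : a ≠ b) (ha : G.Adj v a) (hb : G.Adj v b) :
    2 ≤ G.degree v := by
  classical
  rw [← card_neighborFinset_eq_degree, ← Finset.card_pair hab]
  refine Finset.card_le_card fun x hx => ?_
  rcases Finset.mem_insert.mp hx with rfl | hx
  · exact (mem_neighborFinset _ _ _).mpr ha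
  · rw [Finset.mem_singleton] at hx
    exact (mem_neighborFinset _ _ _).mpr (hx ▸ hb)

theorem two_le_degree_of_embedding (f : cycleGraph (n + 3) ↪g G) (i : Fin (n + 3)) :
    2 ≤ G.degree (f i) := by
  obtain ⟨a, b, hab, ha, hb⟩ := exists_adj_cycleGraph i
  exact two_le_degree_of_adj (fun h => hab (f.injective h)) (f.map_rel_iff.mpr ha)
    (f.map_rel_iff.mpr hb)

/-- The embedding of the cycle of a sun-like graph into the graph. -/
def coreEmbedding (φ : cycleGraph (n + 3) ≃g core G) : cycleGraph (n + 3) ↪g G :=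
  φ.toEmbedding.trans (Embedding.induce _)

theorem coreEmbedding_apply (φ : cycleGraph (n + 3) ≃g core G) (i : Fin (n + 3)) :
    coreEmbedding φ i = (φ i).1 := rfl

theorem range_coreEmbedding (φ : cycleGraph (n + 3) ≃g core G) :
    Set.range (coreEmbedding φ) = {v | G.degree v ≠ 1} := by
  ext v
  constructor
  · rintro ⟨i, rfl⟩
    exact (φ i).2
  · intro hv
    exact ⟨φ.symm ⟨v, hv⟩, by rw [coreEmbedding_apply, RelIso.apply_symm_apply]⟩

theorem two_le_degree_core (φ : cycleGraph (n + 3) ≃g core G) (i : Fin (n + 3)) :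
    2 ≤ G.degree (φ i).1 :=
  two_le_degree_of_embedding (coreEmbedding φ) i

theorem card_compl_core (φ : cycleGraph (n + 3) ≃g core G) :
    (Fintype.card ({v : V | G.degree v ≠ 1}ᶜ : Set V) : ℝ) = Fintype.card V - (n + 3 : ℕ) := by
  have h : Fintype.card {v : V | G.degree v ≠ 1} = n + 3 := by
    rw [← Fintype.card_congr φ.toEquiv, Fintype.card_fin]
  have h2 := Fintype.card_subtype_compl (fun v : V => v ∈ {v : V | G.degree v ≠ 1})
  have h3 : Fintype.card {v : V | G.degree v ≠ 1} ≤ Fintype.card V := Fintype.card_subtype_le _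
  have h4 : Fintype.card ({v : V | G.degree v ≠ 1}ᶜ : Set V) = Fintype.card V - (n + 3) := by
    rw [← h]; exact h2
  rw [h4, Nat.cast_sub (h ▸ h3)]

theorem sum_degree_eq_sum_core (φ : cycleGraph (n + 3) ≃g core G) (g : ℕ → ℝ) :
    ∑ v, g (G.degree v) = ∑ i, g (G.degree (φ i).1) +
      (Fintype.card V - (n + 3 : ℕ)) * g 1 := by
  rw [← Fintype.sum_subtype_add_sum_subtype (fun v => v ∈ {v : V | G.degree v ≠ 1})
    (fun v => g (G.degree v))]
  congr 1
  · exact (Equiv.sum_comp φ.toEquiv (fun v : {v : V | G.degree v ≠ 1} => g (G.degree v.1))).symm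
  · have h : ∀ v : ({v : V | G.degree v ≠ 1}ᶜ : Set V), g (G.degree v.1) = g 1 :=
      fun v => by rw [not_not.mp v.2]
    change ∑ v : ({v : V | G.degree v ≠ 1}ᶜ : Set V), g (G.degree v.1) = _
    rw [Finset.sum_congr rfl fun v _ => h v, Finset.sum_const, Finset.card_univ, nsmul_eq_mul,
      card_compl_core φ]

/-- Double counting of the edges between the cycle and the leaves: each leaf has exactly one
neighbour, and it lies on the cycle. -/
theorem sum_degree_core_sub_two (hG : G.Connected) (φ : cycleGraph (n + 3) ≃g core G) :
    ∑ i, ((G.degree (φ i).1 : ℝ) - 2) = Fintype.card V - (n + 3 : ℕ) := by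
  have h1 : ∀ i, (G.degree (φ i).1 : ℝ) - 2 =
      ∑ l : ({v : V | G.degree v ≠ 1}ᶜ : Set V), if G.Adj (φ i).1 l then (1 : ℝ) else 0 := by
    intro i
    rw [degree_core_eq φ i, add_sub_cancel_left]
  rw [Finset.sum_congr rfl fun i _ => h1 i, Finset.sum_comm, ← card_compl_core φ]
  have h2 : ∀ l : ({v : V | G.degree v ≠ 1}ᶜ : Set V),
      ∑ i, (if G.Adj (φ i).1 l then (1 : ℝ) else 0) = 1 := by
    intro l
    have hl : G.degree l.1 = 1 := not_not.mp l.2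
    obtain ⟨y, hy, huniq⟩ := degree_eq_one_iff_existsUnique_adj.mp hl
    have hyc := degree_ne_one_of_adj_of_degree_eq_one hG (φ 0).2 hl hy
    have hyφ : (φ (φ.symm ⟨y, hyc⟩)).1 = y := by rw [RelIso.apply_symm_apply]
    rw [Finset.sum_eq_single (φ.symm ⟨y, hyc⟩)]
    · rw [if_pos]
      rw [hyφ]
      exact hy.symm
    · intro i _ hi
      rw [if_neg]
      intro h
      apply hi
      rw [← φ.injective.eq_iff, RelIso.apply_symm_apply]
      exact Subtype.ext (huniq _ h.symm)
    · simp
  rw [Finset.sum_congr rfl fun l _ => h2 l]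
  simp

theorem sum_degree_of_core_iso (hG : G.Connected) (φ : cycleGraph (n + 3) ≃g core G) :
    ∑ v, (G.degree v : ℝ) = 2 * Fintype.card V := by
  have h := sum_degree_core_sub_two hG φ
  rw [sum_degree_eq_sum_core φ (fun d => (d : ℝ))]
  rw [Finset.sum_sub_distrib] at h
  simp only [Finset.sum_const, Finset.card_univ, Fintype.card_fin, nsmul_eq_mul] at h
  push_cast at h ⊢
  linarith

theorem card_edgeFinset_of_sum_degree [DecidableEq V]
    (h : ∑ v, (G.degree v : ℝ) = 2 * Fintype.card V) : G.edgeFinset.card = Fintype.card V := by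
  have h2 : ∑ v, G.degree v = 2 * Fintype.card V := by exact_mod_cast h
  have := G.sum_degrees_eq_twice_card_edges
  omega

end SunLikeDegrees

/-! ### The spectrum forces sun-likeness -/

section Recognition

open SimpleGraph

theorem exists_core_iso_of_range_eq {W : Type*} [Fintype W] {H : SimpleGraph W}
    [DecidableRel H.Adj] {n : ℕ} {f : cycleGraph (n + 3) ↪g H}
    (hf : Set.range f = {v | H.degree v ≠ 1}) : Nonempty (cycleGraph (n + 3) ≃g core H) := by
  let g : Fin (n + 3) → {v : W | H.degree v ≠ 1} := fun i => ⟨f i, hf ▸ Set.mem_range_self i⟩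
  have hg : Function.Bijective g := by
    constructor
    · intro a b hab
      exact f.injective (congrArg Subtype.val hab)
    · rintro ⟨v, hv⟩
      rw [← hf] at hv
      obtain ⟨i, rfl⟩ := hv
      exact ⟨i, rfl⟩
  exact ⟨⟨Equiv.ofBijective g hg, f.map_rel_iff⟩⟩

variable {V W : Type*} [Fintype V] [DecidableEq V] [Fintype W] [DecidableEq W]
  {G : SimpleGraph V} [DecidableRel G.Adj] {H : SimpleGraph W} [DecidableRel H.Adj] {n : ℕ}

/-- A graph with the Laplacian spectrum of a triangle-free sun-like graph of maximum degree at most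
`4` is itself sun-like, with the same cycle length and the same sum of squared degrees, and has
maximum degree at most `4`. -/
theorem core_iso_of_charpoly_eq (hn : 1 ≤ n) (hG : G.Connected)
    (φ : cycleGraph (n + 3) ≃g core G) (h4 : ∀ v, G.degree v ≤ 4)
    (hchar : (H.lapMatrix ℝ).charpoly = (G.lapMatrix ℝ).charpoly) :
    H.Connected ∧ Nonempty (cycleGraph (n + 3) ≃g core H) ∧ (∀ v, H.degree v ≤ 4) ∧
      ∑ v, (H.degree v : ℝ) ^ 2 = ∑ v, (G.degree v : ℝ) ^ 2 := by
  have hcard : Fintype.card W = Fintype.card V := card_eq_of_charpoly_eq hchar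
  have hHc : H.Connected := by
    rw [connected_iff_count_roots, hchar, ← connected_iff_count_roots]; exact hG
  have htr : ∀ m, ((H.lapMatrix ℝ) ^ m).trace = ((G.lapMatrix ℝ) ^ m).trace := fun m => by
    rw [trace_pow_eq_sum_roots (H.isHermitian_lapMatrix ℝ),
      trace_pow_eq_sum_roots (G.isHermitian_lapMatrix ℝ), hchar]
  have hGdeg := sum_degree_of_core_iso hG φ
  have hd1 : ∑ v, (H.degree v : ℝ) = ∑ v, (G.degree v : ℝ) := by
    have := htr 1
    rwa [pow_one, pow_one, trace_lapMatrix, trace_lapMatrix] at this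
  have hd2 : ∑ v, (H.degree v : ℝ) ^ 2 = ∑ v, (G.degree v : ℝ) ^ 2 := by
    have := htr 2
    rw [trace_lapMatrix_sq, trace_lapMatrix_sq, Finset.sum_add_distrib, Finset.sum_add_distrib,
      hd1] at this
    linarith
  have hGE := card_edgeFinset_of_sum_degree hGdeg
  have hHE : H.edgeFinset.card = Fintype.card W :=
    card_edgeFinset_of_sum_degree (by rw [hd1, hGdeg, hcard])
  obtain ⟨m, hm, f, hf, r, -, hr⟩ := exists_cycle_embedding _ G rfl hG hGE
  obtain ⟨m', hm', f', hf', r', -, hr'⟩ := exists_cycle_embedding _ H rfl hHc hHE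
  have hmn : m = n + 3 := by
    obtain ⟨a, rfl⟩ : ∃ a, m = a + 3 := ⟨m - 3, by omega⟩
    have hrange : Set.range f = Set.range (coreEmbedding φ) := by
      refine Set.Subset.antisymm ?_ (hf _ (isTwoDense_range _))
      rw [range_coreEmbedding]
      rintro _ ⟨i, rfl⟩ h
      have := two_le_degree_of_embedding f i
      omega
    have h1 := Nat.card_range_of_injective f.injective
    have h2 := Nat.card_range_of_injective (coreEmbedding φ).injective
    rw [hrange, h2] at h1
    simpa using h1.symm
  -- The linear coefficients agree and the orders agree, so the cofactors agree; these are the cycle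
  -- lengths.
  have hm'n : m' = n + 3 := by
    have h1 := coeff_one_charpoly_lapMatrix G hG r
    have h2 := coeff_one_charpoly_lapMatrix H hHc r'
    rw [hchar, h1, hcard, hr, hr', hmn] at h2
    have hne : Nonempty V := hG.nonempty
    have h3 := mul_left_cancel₀ (pow_ne_zero _ (by norm_num)) h2
    have h4 := mul_left_cancel₀ (Nat.cast_ne_zero.mpr Fintype.card_ne_zero) h3
    exact_mod_cast h4.symm
  subst hm'n
  subst hmn
  have hd3 : ∑ v, (H.degree v : ℝ) ^ 3 = ∑ v, (G.degree v : ℝ) ^ 3 := by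
    have := htr 3
    rw [trace_lapMatrix_cube, trace_lapMatrix_cube,
      trace_adjMatrix_cube_eq_zero G fun u v w => false_of_triangle (by omega) f hf,
      trace_adjMatrix_cube_eq_zero H fun u v w => false_of_triangle (by omega) f' hf',
      Finset.sum_add_distrib, Finset.sum_add_distrib, ← Finset.mul_sum, ← Finset.mul_sum,
      hd2] at this
    linarith
  -- A cubic vanishing at the degrees allowed on the cycle and nonnegative at every integer from 2
  -- on; its value at a leaf is -6.
  let P : ℕ → ℝ := fun d => ((d : ℝ) - 2) * (d - 3) * (d - 4)
  have hPexp : ∀ d : ℕ, P d = (d : ℝ) ^ 3 - 9 * (d : ℝ) ^ 2 + 26 * d - 24 := fun d => by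
    simp only [P]; ring
  have hP : ∑ v, P (H.degree v) = ∑ v, P (G.degree v) := by
    simp only [hPexp, Finset.sum_sub_distrib, Finset.sum_add_distrib, ← Finset.mul_sum, hd1, hd2,
      hd3, Finset.sum_const, Finset.card_univ, hcard]
  have hPG : ∑ v, P (G.degree v) = -6 * (Fintype.card V - (n + 3 : ℕ)) := by
    rw [sum_degree_eq_sum_core φ P, Finset.sum_eq_zero, zero_add]
    · simp only [P]; push_cast; ring
    · intro i _
      have h1 := two_le_degree_core φ i
      have h2 := h4 (φ i).1
      generalize G.degree (φ i).1 = d at *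
      interval_cases d <;> simp [P]
  have hpos : ∀ d : ℕ, 2 ≤ d → 0 ≤ P d ∧ (P d = 0 → d ≤ 4) := by
    intro d hd
    rcases Nat.lt_or_ge 4 d with h | h
    · have : (5 : ℝ) ≤ d := by exact_mod_cast h
      have hlt : 0 < P d := by
        simp only [P]
        have a1 : (0 : ℝ) < (d : ℝ) - 2 := by linarith
        have a2 : (0 : ℝ) < (d : ℝ) - 3 := by linarith
        have a3 : (0 : ℝ) < (d : ℝ) - 4 := by linarith
        positivity
      exact ⟨hlt.le, fun h => absurd h hlt.ne'⟩
    · interval_cases d <;> simp [P]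
  have hdegpos : ∀ v, 1 ≤ H.degree v := by
    intro v
    have : Nontrivial W := ⟨f' 0, f' 1, fun h => by
      have := f'.injective h
      simp at this⟩
    exact hHc.preconnected.degree_pos_of_nontrivial v
  classical
  have hlow : ∀ v, (if v ∈ Set.range f' then (0 : ℝ) else -6) ≤ P (H.degree v) := by
    intro v
    split_ifs with hv
    · obtain ⟨i, rfl⟩ := hv
      exact (hpos _ (two_le_degree_of_embedding f' i)).1
    · rcases Nat.lt_or_ge (H.degree v) 2 with h | h
      · have h1 : H.degree v = 1 := by have := hdegpos v; omega
        rw [h1]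
        simp only [P]
        norm_num
      · exact le_trans (by norm_num) (hpos _ h).1
  have hsumlow : ∑ v, (if v ∈ Set.range f' then (0 : ℝ) else -6) =
      -6 * (Fintype.card V - (n + 3 : ℕ)) := by
    have h1 : ∑ v, (if v ∈ Set.range f' then (0 : ℝ) else -6) =
        ∑ v : W, ((-6 : ℝ) + 6 * if v ∈ Finset.univ.image f' then 1 else 0) := by
      refine Finset.sum_congr rfl fun v _ => ?_
      simp only [Set.mem_range, Finset.mem_image, Finset.mem_univ, true_and]
      split_ifs <;> norm_num
    rw [h1, Finset.sum_add_distrib, ← Finset.mul_sum, Finset.sum_boole, Finset.filter_mem_eq_inter,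
      Finset.univ_inter, Finset.card_image_of_injective _ f'.injective]
    simp only [Finset.sum_const, Finset.card_univ, Fintype.card_fin, hcard, nsmul_eq_mul]
    push_cast
    ring
  -- The termwise lower bounds add up to the actual total, so each is attained: -6 forces a leaf off
  -- the cycle, and 0 forces degree at most 4 on it.
  have heq : ∀ v, (if v ∈ Set.range f' then (0 : ℝ) else -6) = P (H.degree v) := by
    intro v
    refine (Finset.sum_eq_sum_iff_of_le fun v _ => hlow v).mp ?_ v (Finset.mem_univ v)
    rw [hsumlow, hP, hPG]
  have hleaf : ∀ v, v ∉ Set.range f' → H.degree v = 1 := by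
    intro v hv
    have h := heq v
    rw [if_neg hv] at h
    by_contra hne
    have h1 : 2 ≤ H.degree v := by have := hdegpos v; omega
    have := (hpos _ h1).1
    linarith
  refine ⟨hHc, exists_core_iso_of_range_eq (f := f') ?_, ?_, hd2⟩
  · ext v
    constructor
    · rintro ⟨i, rfl⟩ h
      have := two_le_degree_of_embedding f' i
      omega
    · intro hv
      by_contra hv'
      exact hv (hleaf v hv')
  · intro v
    by_cases hv : v ∈ Set.range f'
    · have h := heq v
      rw [if_pos hv] at h
      obtain ⟨i, rfl⟩ := hv
      exact (hpos _ (two_le_degree_of_embedding f' i)).2 h.symm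
    · rw [hleaf v hv]; norm_num

end Recognition

/-! ### Hubs expressed as weights on the cycle -/

section HubWeight

open SimpleGraph

variable {V : Type*} [Fintype V] {G : SimpleGraph V} [DecidableRel G.Adj] {n : ℕ}

/-- The number of leaves attached to a vertex of the cycle of a sun-like graph. -/
def hubWeight (φ : cycleGraph (n + 3) ≃g core G) (i : Fin (n + 3)) : ℕ :=
  G.degree (φ i).1 - 2

theorem degree_core_eq_hubWeight (φ : cycleGraph (n + 3) ≃g core G) (i : Fin (n + 3)) :
    G.degree (φ i).1 = hubWeight φ i + 2 :=
  (Nat.sub_add_cancel (two_le_degree_core φ i)).symm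

theorem isIHub_core_iff (φ : cycleGraph (n + 3) ≃g core G) {a : ℕ} (ha : 1 ≤ a)
    (i : Fin (n + 3)) : IsIHub G a (φ i).1 ↔ hubWeight φ i = a := by
  rw [IsIHub, degree_core_eq_hubWeight]
  omega

theorem exists_eq_of_isIHub (φ : cycleGraph (n + 3) ≃g core G) {a : ℕ} {v : V}
    (h : IsIHub G a v) : ∃ i, (φ i).1 = v ∧ hubWeight φ i = a := by
  have hv : v ∈ {v : V | G.degree v ≠ 1} := by
    have h1 := h.2
    change G.degree v ≠ 1
    omega
  have h1 : (φ (φ.symm ⟨v, hv⟩)).1 = v := by rw [RelIso.apply_symm_apply]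
  refine ⟨φ.symm ⟨v, hv⟩, h1, ?_⟩
  rw [← isIHub_core_iff φ h.1, h1]
  exact h

theorem setOf_isHub_eq (φ : cycleGraph (n + 3) ≃g core G) :
    {v | IsHub G v} = (fun i => (φ i).1) '' {i | hubWeight φ i ≠ 0} := by
  ext v
  constructor
  · rintro ⟨a, ha⟩
    obtain ⟨i, hi, hw⟩ := exists_eq_of_isIHub φ ha
    exact ⟨i, by have := ha.1; change hubWeight φ i ≠ 0; omega, hi⟩
  · rintro ⟨i, hi, rfl⟩
    exact ⟨hubWeight φ i, (isIHub_core_iff φ (Nat.one_le_iff_ne_zero.mpr hi) i).mpr rfl⟩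

theorem ncard_setOf_isHub (φ : cycleGraph (n + 3) ≃g core G) :
    {v | IsHub G v}.ncard = (Finset.univ.filter fun i => hubWeight φ i ≠ 0).card := by
  rw [setOf_isHub_eq φ, Set.ncard_image_of_injective _
    (fun a b h => φ.injective (Subtype.ext h)), ← Set.ncard_coe_finset]
  simp

theorem existsUnique_isIHub_one_iff (φ : cycleGraph (n + 3) ≃g core G) :
    (∃! v, IsIHub G 1 v) ↔ ∃! i, hubWeight φ i = 1 := by
  constructor
  · rintro ⟨v, hv, huniq⟩
    obtain ⟨i, rfl, hi⟩ := exists_eq_of_isIHub φ hv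
    refine ⟨i, hi, fun j hj => φ.injective (Subtype.ext ?_)⟩
    exact huniq _ ((isIHub_core_iff φ le_rfl j).mpr hj)
  · rintro ⟨i, hi, huniq⟩
    refine ⟨(φ i).1, (isIHub_core_iff φ le_rfl i).mpr hi, fun v hv => ?_⟩
    obtain ⟨j, rfl, hj⟩ := exists_eq_of_isIHub φ hv
    rw [huniq j hj]

theorem eval_charpoly_eq_reducedMatrix [DecidableEq V] (hG : G.Connected)
    (φ : cycleGraph (n + 3) ≃g core G) {x : ℝ} (hx : x ≠ 1) :
    (G.lapMatrix ℝ).charpoly.eval x =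
      (x - 1) ^ (Fintype.card V - (n + 3)) * (reducedMatrix (hubWeight φ) x).det := by
  rw [eval_charpoly_lapMatrix_of_core_iso hG φ hx, reducedMatrix]
  simp only [degree_core_eq_hubWeight, Nat.cast_add, Nat.cast_ofNat, add_sub_cancel_right]

theorem sum_hubWeight (hG : G.Connected) (φ : cycleGraph (n + 3) ≃g core G) :
    ∑ i, (hubWeight φ i : ℝ) = Fintype.card V - (n + 3 : ℕ) := by
  rw [← sum_degree_core_sub_two hG φ]
  exact Finset.sum_congr rfl fun i _ => by rw [degree_core_eq_hubWeight]; push_cast; ring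

theorem sum_degree_sq_eq (hG : G.Connected) (φ : cycleGraph (n + 3) ≃g core G) :
    ∑ v, (G.degree v : ℝ) ^ 2 = ∑ i, (hubWeight φ i : ℝ) ^ 2 +
      5 * Fintype.card V - (n + 3 : ℕ) := by
  rw [sum_degree_eq_sum_core φ (fun d => (d : ℝ) ^ 2)]
  have h : ∀ i, (G.degree (φ i).1 : ℝ) ^ 2 = (hubWeight φ i : ℝ) ^ 2 + 4 * hubWeight φ i + 4 := by
    intro i
    rw [degree_core_eq_hubWeight]
    push_cast
    ring
  simp only [h, Finset.sum_add_distrib, ← Finset.mul_sum, sum_hubWeight hG φ, Finset.sum_const,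
    Finset.card_univ, Fintype.card_fin, nsmul_eq_mul]
  push_cast
  ring

end HubWeight

/-! ### Weight multiplicities from power sums -/

section WeightCounts

variable {n : ℕ}

/-- Three unknown multiplicities, of the weights 0, 1, 2, are determined by the power sums of orders
0, 1, 2. -/
theorem card_weights_eq {c c' : Fin (n + 3) → ℕ} (h : ∀ i, c i ≤ 2) (h' : ∀ i, c' i ≤ 2)
    (h1 : ∑ i, (c i : ℝ) = ∑ i, (c' i : ℝ)) (h2 : ∑ i, (c i : ℝ) ^ 2 = ∑ i, (c' i : ℝ) ^ 2)
    (a : ℕ) : (Finset.univ.filter fun i => c i = a).card =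
      (Finset.univ.filter fun i => c' i = a).card := by
  have e1 : ∑ i, c i = ∑ i, c' i := by exact_mod_cast h1
  have e2 : ∑ i, c i ^ 2 = ∑ i, c' i ^ 2 := by exact_mod_cast h2
  have key : ∀ c : Fin (n + 3) → ℕ, (∀ i, c i ≤ 2) →
      ∑ i, c i = (Finset.univ.filter fun i => c i = 1).card +
        2 * (Finset.univ.filter fun i => c i = 2).card ∧
      ∑ i, c i ^ 2 = (Finset.univ.filter fun i => c i = 1).card +
        4 * (Finset.univ.filter fun i => c i = 2).card ∧
      n + 3 = (Finset.univ.filter fun i => c i = 0).card +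
        (Finset.univ.filter fun i => c i = 1).card +
        (Finset.univ.filter fun i => c i = 2).card := by
    intro c h
    have hn : n + 3 = ∑ _i : Fin (n + 3), 1 := by simp
    simp only [Finset.card_filter, Finset.mul_sum, ← Finset.sum_add_distrib]
    refine ⟨?_, ?_, hn.trans ?_⟩ <;>
    · refine Finset.sum_congr rfl fun i _ => ?_
      have := h i
      generalize c i = b at *
      interval_cases b <;> simp
  obtain ⟨a1, a2, a3⟩ := key c h
  obtain ⟨b1, b2, b3⟩ := key c' h'
  rcases Nat.lt_or_ge 2 a with ha | ha
  · rw [Finset.filter_false_of_mem fun i _ => by have := h i; omega,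
      Finset.filter_false_of_mem fun i _ => by have := h' i; omega]
  · interval_cases a <;> omega

theorem prod_eq_of_card_weights_eq {R : Type*} [CommMonoid R] {c c' : Fin (n + 3) → ℕ}
    (h : ∀ a, (Finset.univ.filter fun i => c i = a).card =
      (Finset.univ.filter fun i => c' i = a).card) (g : ℕ → R) :
    ∏ i, g (c i) = ∏ i, g (c' i) := by
  have hm : Finset.univ.val.map c = Finset.univ.val.map c' := by
    ext a
    have := h a
    rw [Finset.card_def, Finset.card_def, Finset.filter_val, Finset.filter_val] at this
    rw [Multiset.count_map, Multiset.count_map]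
    simpa [eq_comm] using this
  have := congrArg (fun s => (s.map g).prod) hm
  simp only [Multiset.map_map] at this
  exact this

theorem existsUnique_iff_card_eq_one {c : Fin (n + 3) → ℕ} {a : ℕ} :
    (∃! i, c i = a) ↔ (Finset.univ.filter fun i => c i = a).card = 1 := by
  rw [Finset.card_eq_one]
  constructor
  · rintro ⟨i, hi, huniq⟩
    refine ⟨i, ?_⟩
    ext j
    simp only [Finset.mem_filter, Finset.mem_univ, true_and, Finset.mem_singleton]
    exact ⟨huniq j, fun h => h ▸ hi⟩
  · rintro ⟨i, hi⟩
    have h : ∀ j, c j = a ↔ j = i := by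
      intro j
      have : j ∈ (Finset.univ.filter fun i => c i = a) ↔ j ∈ ({i} : Finset _) := by rw [hi]
      simpa using this
    exact ⟨i, (h i).mpr rfl, fun j hj => (h j).mp hj⟩

end WeightCounts

/-! ### Rotations and reflections of the cycle -/

section CycleAutomorphisms

open SimpleGraph

variable {n : ℕ}

/-- Rotation of the cycle. -/
def cycleRotation (r : Fin (n + 3)) : cycleGraph (n + 3) ≃g cycleGraph (n + 3) where
  toEquiv := Equiv.addLeft r
  map_rel_iff' := by
    intro a b
    simp only [Equiv.coe_addLeft, cycleGraph_adj_val, add_sub_add_left_eq_sub]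

/-- Reflection of the cycle. -/
def cycleReflection (r : Fin (n + 3)) : cycleGraph (n + 3) ≃g cycleGraph (n + 3) where
  toEquiv := Equiv.subLeft r
  map_rel_iff' := by
    intro a b
    simp only [Equiv.subLeft_apply, cycleGraph_adj_val, sub_sub_sub_cancel_left]
    exact or_comm

end CycleAutomorphisms

/-! ### Assembling the proof -/

section Main

open SimpleGraph

/-- A sun-like graph whose hubs have the local statistics of a nice graph is nice. -/
theorem isNice_of_hasNiceCounts {W : Type*} [Fintype W] {H : SimpleGraph W} [DecidableRel H.Adj]
    {n k : ℕ} (hk : 1 ≤ k) (hmax : max (12 * k) 15 ≤ n + 3) (hH : H.Connected)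
    (ψ : cycleGraph (n + 3) ≃g core H) (hp : IsHubPattern (hubWeight ψ))
    (hc : HasNiceCounts (hubWeight ψ) k) (h6 : Even (pairCount (hubWeight ψ) 2 6))
    (hone : ∃! i, hubWeight ψ i = 1)
    (hcard : (Finset.univ.filter fun i => hubWeight ψ i ≠ 0).card = k + 1) :
    IsNice H (n + 3) k := by
  -- The pair of weight 2 at distance 4 fixes the orientation: rotate if the 1-hub comes first in
  -- it, reflect if it comes second.
  have hpos : ∃ e : cycleGraph (n + 3) ≃g cycleGraph (n + 3),
      (∀ m d, pairCount (hubWeight (e.trans ψ)) m d = pairCount (hubWeight ψ) m d) ∧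
      (∀ u v, (v - u).val = (e v - e u).val ∨ (v - u).val = (e u - e v).val) ∧
      hubWeight ψ (e 0) = 1 ∧ ∃ w : Fin (n + 3), w.val = 4 ∧ hubWeight ψ (e w) ≠ 0 := by
    have h24 : pairCount (hubWeight ψ) 2 4 ≠ 0 := by rw [hc.two_four]; norm_num
    rw [Ne, pairCount_eq_zero_iff] at h24
    push Not at h24
    obtain ⟨u, v, huv, hd, hm⟩ := h24
    have hu2 := hp.le_two u
    have hv2 := hp.le_two v
    have hne0 : hubWeight ψ u ≠ 0 ∧ hubWeight ψ v ≠ 0 := by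
      constructor <;> intro h <;> rw [h] at hm <;> omega
    have h1 : hubWeight ψ u = 1 ∨ hubWeight ψ v = 1 := by
      generalize hubWeight ψ u = a at *
      generalize hubWeight ψ v = b at *
      interval_cases a <;> interval_cases b <;> simp_all
    rcases h1 with h1 | h1
    · refine ⟨cycleRotation u, fun m d => pairCount_comp_add (c := hubWeight ψ) u m d, fun a b => Or.inl ?_, ?_,
        v - u, hd, ?_⟩
      · change _ = ((u + b) - (u + a)).val
        rw [add_sub_add_left_eq_sub]
      · change hubWeight ψ (u + 0) = 1
        rw [add_zero, h1]
      · change hubWeight ψ (u + (v - u)) ≠ 0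
        rw [add_sub_cancel]
        exact hne0.2
    · refine ⟨cycleReflection v, fun m d => pairCount_comp_sub (c := hubWeight ψ) v m d, fun a b => Or.inr ?_, ?_,
        v - u, hd, ?_⟩
      · change _ = ((v - a) - (v - b)).val
        rw [sub_sub_sub_cancel_left]
      · change hubWeight ψ (v - 0) = 1
        rw [sub_zero, h1]
      · change hubWeight ψ (v - (v - u)) ≠ 0
        rw [sub_sub_cancel]
        exact hne0.1
  obtain ⟨e, hcount, hsub, he0, w, hw4, hew⟩ := hpos
  have happ : ∀ i, hubWeight (e.trans ψ) i = hubWeight ψ (e i) := fun _ => rfl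
  have hp' : IsHubPattern (hubWeight (e.trans ψ)) :=
    ⟨fun u => hp.le_two (e u), fun u v hu hv => e.injective (hp.eq_of_one _ _ hu hv)⟩
  have hc' : HasNiceCounts (hubWeight (e.trans ψ)) k := by
    refine ⟨?_, ?_, ?_, ?_, ?_⟩
    · intro u v huv hu hv
      have hne : e u ≠ e v := fun h => huv (e.injective h)
      rcases hsub u v with h | h <;> rw [h]
      · exact hc.separated _ _ hne hu hv
      · exact hc.separated _ _ hne.symm hv hu
    · rw [hcount, hc.two_four]
    · rw [hcount, hc.two_five]
    · rw [hcount, hc.four_five]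
    · simp only [hcount]
      exact hc.le_card
  have hcard' : (Finset.univ.filter fun i => hubWeight (e.trans ψ) i ≠ 0).card = k + 1 := by
    rw [← hcard]
    refine Finset.card_bijective e e.bijective fun i => ?_
    simp [happ]
  obtain ⟨p, hp0, hp1, hstep, hp2⟩ := exists_positions hk hp' hc' hcard'
    (by rw [happ, he0]) ⟨w, hw4, by rw [happ]; exact hew⟩ (by rw [hcount]; exact h6)
  refine ⟨hk, hmax, ⟨hH, by omega, ⟨ψ⟩⟩, by rw [ncard_setOf_isHub ψ, hcard],
    (existsUnique_isIHub_one_iff ψ).mpr hone, ?_, e.trans ψ, p, hp0, ?_, hp1, hstep, ?_⟩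
  · rintro v ⟨a, ha⟩
    obtain ⟨i, rfl, hi⟩ := exists_eq_of_isIHub ψ ha
    have h1 := ha.1
    have h2 := hp.le_two i
    rcases (by omega : a = 1 ∨ a = 2) with rfl | rfl
    · exact Or.inl ha
    · exact Or.inr ha
  · rw [isIHub_core_iff _ le_rfl, show p 0 = 0 from Fin.ext hp0, happ, he0]
  · intro j hj hjk
    rw [isIHub_core_iff _ (by norm_num)]
    exact hp2 j hj hjk

theorem hasNiceCounts_of_isNice {V : Type*} [Fintype V] {G : SimpleGraph V} [DecidableRel G.Adj]
    {n k : ℕ} (hG : IsNice G (n + 3) k) :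
    ∃ φ : cycleGraph (n + 3) ≃g core G, IsHubPattern (hubWeight φ) ∧
      HasNiceCounts (hubWeight φ) k ∧ pairCount (hubWeight φ) 2 6 = 0 := by
  obtain ⟨φ, p, hp0, hhub0, hp1, hstep, hhub2⟩ := hG.positions
  refine ⟨φ, ?_⟩
  have hc0 : hubWeight φ (p 0) = 1 := (isIHub_core_iff φ le_rfl _).mp hhub0
  have hc2 : ∀ j, 1 ≤ j → j ≤ k → hubWeight φ (p j) = 2 := fun j h1 h2 =>
    (isIHub_core_iff φ (by norm_num) _).mp (hhub2 j h1 h2)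
  have hinj : Set.InjOn p (Finset.range (k + 1) : Set ℕ) := by
    intro i hi j hj hij
    have hi' : i < k + 1 := by simpa using hi
    have hj' : j < k + 1 := by simpa using hj
    by_contra hne
    rcases lt_or_gt_of_ne hne with h | h
    · have g := le_position_sub hp0 hp1 hstep (j := i) (d := j - i) (by omega)
      rw [show i + (j - i) = j by omega, hij] at g
      omega
    · have g := le_position_sub hp0 hp1 hstep (j := j) (d := i - j) (by omega)
      rw [show j + (i - j) = i by omega, hij] at g
      omega
  -- The k + 1 positions are distinct and there are exactly k + 1 hubs, so no other hub exists.
  have himage : (Finset.range (k + 1)).image p =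
      Finset.univ.filter fun i => hubWeight φ i ≠ 0 := by
    refine Finset.eq_of_subset_of_card_le ?_ ?_
    · intro u hu
      obtain ⟨j, hj, rfl⟩ := Finset.mem_image.mp hu
      have hj' : j < k + 1 := by simpa using hj
      simp only [Finset.mem_filter, Finset.mem_univ, true_and]
      rcases Nat.eq_zero_or_pos j with rfl | h
      · rw [hc0]; norm_num
      · rw [hc2 j h (by omega)]; norm_num
    · rw [Finset.card_image_of_injOn hinj, Finset.card_range, ← ncard_setOf_isHub φ, hG.card_hubs]
  have hhub : ∀ u, hubWeight φ u ≠ 0 → ∃ j ≤ k, p j = u := by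
    intro u hu
    have : u ∈ (Finset.range (k + 1)).image p := by rw [himage]; simp [hu]
    obtain ⟨j, hj, rfl⟩ := Finset.mem_image.mp this
    exact ⟨j, by simpa [Nat.lt_succ_iff] using hj, rfl⟩
  exact ⟨isHubPattern_of_positions hc0 hc2 hhub,
    hasNiceCounts_of_positions hG.one_le hG.max_le hp0 hp1 hstep hc0 hc2 hhub⟩

theorem isNice_of_charpoly_eq {V W : Type*} [Fintype V] [DecidableEq V] [Fintype W]
    [DecidableEq W] {G : SimpleGraph V} [DecidableRel G.Adj] {H : SimpleGraph W}
    [DecidableRel H.Adj] {n k : ℕ} (hG : IsNice G (n + 3) k)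
    (hchar : (H.lapMatrix ℝ).charpoly = (G.lapMatrix ℝ).charpoly) : IsNice H (n + 3) k := by
  have hmax := hG.max_le
  have hn : 12 ≤ n := by have := le_max_right (12 * k) 15; omega
  have hGc := hG.sunLike.connected
  obtain ⟨φ, hpG, hcG, h6G⟩ := hasNiceCounts_of_isNice hG
  have hG4 : ∀ v, G.degree v ≤ 4 := by
    intro v
    by_cases hv : G.degree v ≤ 2
    · omega
    · obtain ⟨i, rfl, -⟩ := exists_eq_of_isIHub φ (a := G.degree v - 2) (v := v)
        ⟨by omega, by omega⟩
      have := hpG.le_two i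
      rw [degree_core_eq_hubWeight]
      omega
  obtain ⟨hHc, ⟨ψ⟩, hH4, hsq⟩ := core_iso_of_charpoly_eq (by omega) hGc φ hG4 hchar
  have hcard : Fintype.card W = Fintype.card V := card_eq_of_charpoly_eq hchar
  have hle : ∀ i, hubWeight ψ i ≤ 2 := by
    intro i
    have := hH4 (ψ i).1
    rw [degree_core_eq_hubWeight] at this
    omega
  have hcounts := card_weights_eq hle hpG.le_two
    (by rw [sum_hubWeight hHc ψ, sum_hubWeight hGc φ, hcard])
    (by
      rw [sum_degree_sq_eq hHc ψ, sum_degree_sq_eq hGc φ, hcard] at hsq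
      linarith)
  have hone : ∃! i, hubWeight ψ i = 1 := by
    rw [existsUnique_iff_card_eq_one, hcounts, ← existsUnique_iff_card_eq_one,
      ← existsUnique_isIHub_one_iff]
    exact hG.one_hub
  have hpH : IsHubPattern (hubWeight ψ) := ⟨hle, fun u v hu hv => hone.unique hu hv⟩
  have hnz : ∀ c : Fin (n + 3) → ℕ, (Finset.univ.filter fun i => c i ≠ 0).card =
      n + 3 - (Finset.univ.filter fun i => c i = 0).card := by
    intro c
    have := Finset.card_filter_add_card_filter_not (s := Finset.univ) (fun i => c i = 0)
    rw [Finset.card_univ, Fintype.card_fin] at this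
    simp only [ne_eq]
    omega
  have hcardH : (Finset.univ.filter fun i => hubWeight ψ i ≠ 0).card = k + 1 := by
    rw [hnz, hcounts, ← hnz, ← ncard_setOf_isHub φ, hG.card_hubs]
  have hdet : (hubMatrix (hubWeight φ)).det = (hubMatrix (hubWeight ψ)).det := by
    refine det_hubMatrix_eq fun x hx => ?_
    have h1 := eval_charpoly_eq_reducedMatrix hGc φ hx
    have h2 := eval_charpoly_eq_reducedMatrix hHc ψ hx
    rw [hchar, h1, hcard] at h2
    exact mul_left_cancel₀ (pow_ne_zero _ (sub_ne_zero.mpr hx)) h2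
  have hprod : ∏ w, hubDiag n (hubWeight φ w) = ∏ w, hubDiag n (hubWeight ψ w) :=
    prod_eq_of_card_weights_eq (fun a => (hcounts a).symm) (hubDiag n)
  obtain ⟨hs, h24, h25, h45, h44, h6⟩ := hcG.transfer hn hpG hpH hprod hdet h6G
  have hle6 := hcG.le_card
  refine isNice_of_hasNiceCounts hG.one_le hmax hHc ψ hpH ⟨hs, h24, h25, h45, ?_⟩ ?_ hone hcardH
  -- Write a, b for the counts of H at distance 6 with products 2 and 4, and B for that of G with
  -- product 4. From a + 2b = 2B follow b ≤ B and a + b = 2B - b ≥ B, so H has at least as many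
  -- links as G; moreover a = 2(B - b) is even.
  · rw [hcG.two_four] at hle6
    omega
  · exact ⟨pairCount (hubWeight φ) 4 6 - pairCount (hubWeight ψ) 4 6, by omega⟩

end Main

end SpectralNice

theorem lemma4p2 {V W : Type*} [Fintype V] [DecidableEq V] [Fintype W] [DecidableEq W]
    (G : SimpleGraph V) [DecidableRel G.Adj] (H : SimpleGraph W) [DecidableRel H.Adj]
    (ℓ k : ℕ) (hG : SpectralNice.IsNice G ℓ k)
    (hspec : SpectralNice.laplacianSpectrum H = SpectralNice.laplacianSpectrum G) :
    SpectralNice.IsNice H ℓ k := by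
  obtain ⟨n, rfl⟩ : ∃ n, ℓ = n + 3 := ⟨ℓ - 3, by have := hG.sunLike.three_le; omega⟩
  exact SpectralNice.isNice_of_charpoly_eq hG
    (SpectralNice.charpoly_eq_of_laplacianSpectrum_eq hspec)
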